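/- All rings are commutative with $1$, and $[x,y]=xyx^{-1}y^{-1}$. For a simply-laced (finite, reduced, crystallographic) root system $\Phi$ and a ring $R$, the Steinberg group $\mathrm{St}(\Phi,R)$ is the group with generators $x_\alpha(a)$ ($\alpha\in\Phi$, $a\in R$) and relations $$x_\alpha(a)x_\alpha(b)=x_\alpha(a+b),$$ $$[x_\alpha(a),x_\beta(b)]=x_{\alpha+\beta}(N_{\alpha,\beta}\,ab)\ \text{ if } \alpha+\beta\in\Phi,\qquad [x_\alpha(a),x_\beta(b)]=1\ \text{ if } \alpha+\beta\notin\Phi\cup\{0\},$$ where the $N_{\alpha,\beta}=\pm1$ are the structure constants of the complex semisimple Lie algebra of type $\Phi$ with respect to root vectors $e_\alpha$ such that $[e_\alpha,e_{-\alpha}]$ is the coroot of $\alpha$ and $[e_\alpha,e_\beta]=N_{\alpha,\beta}e_{\alpha+\beta}$. It is functorial in $R$; $f^*$ denotes the homomorphism induced by a ring homomorphism $f$. For an ideal $I$ of $R$ let $p_1,p_2\colon R\times_{R/I}R\to R$ be the two projections. The relative Steinberg group is $\mathrm{St}(\Phi,R,I)=\mathrm{Ker}(p_1^*)/[\mathrm{Ker}(p_1^*),\mathrm{Ker}(p_2^*)]$,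 and $\mu\colon\mathrm{St}(\Phi,R,I)\to\mathrm{St}(\Phi,R)$ is the homomorphism induced by $p_2^*$. Let $\Psi$ be an irreducible simply-laced root system of rank $\geq 3$ embedded into an irreducible simply-laced root system $\Phi$, let $\mathrm{St}(\Psi,R)$ be formed with the restriction to $\Psi$ of the structure constants of $\Phi$, and let $j_R\colon\mathrm{St}(\Psi,R)\to\mathrm{St}(\Phi,R)$, $x_\alpha(a)\mapsto x_\alpha(a)$, be the homomorphism induced by the embedding. Let $A$ be any commutative ring, and for a maximal ideal $M$ of $A$ let $\lambda_M\colon A[X]\to A_M[X]$ be the localization of coefficients. **Corollary (local-global principle for subsystem embeddings).** For $g\in\mathrm{St}(\Phi,A[X],XA[X])$, the element $\mu(g)\in\mathrm{St}(\Phi,A[X])$ belongs to $\mathrm{Im}(j_{A[X]})$ if and only if $\lambda_M^*(\mu(g))\in\mathrm{St}(\Phi,A_M[X])$ belongs to $\mathrm{Im}(j_{A_M[X]})$ for every maximal ideal $M$ of $A$. -/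

import Mathlib

namespace RelSteinberg

noncomputable section

open Module

section RootSystems

variable {ι κ V V' W W' : Type*}
  [AddCommGroup V] [Module ℝ V] [AddCommGroup V'] [Module ℝ V']
  [AddCommGroup W] [Module ℝ W] [AddCommGroup W'] [Module ℝ W']

/-- A (reduced, crystallographic) root system is simply laced if the Cartan integers satisfy
`⟨α, β⟩ = ⟨β, α⟩` for all roots, i.e. in each irreducible component all roots have the same
length. -/
def IsSimplyLaced (Φ : RootPairing ι ℝ V V') : Prop :=
  ∀ i j, Φ.pairing i j = Φ.pairing j i

/-- `N` is a system of structure constants for `Φ`: there are a complex semisimple Lie algebra `L`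
with a Cartan subalgebra `H` whose root system is `Φ` (identified through `φ`), and root vectors
`e α` with `[e α, e (-α)]` the coroot of `α`, such that
`[e α, e β] = N α β • e (α + β)`, with `N α β = ± 1`, whenever `α + β` is a root. -/
def IsStructureConstants (Φ : RootPairing ι ℝ V V') (N : ι → ι → ℤ) : Prop :=
  ∃ (L : Type) (_ : LieRing L) (_ : LieAlgebra ℂ L) (_ : FiniteDimensional ℂ L)
    (_ : LieAlgebra.IsKilling ℂ L) (H : LieSubalgebra ℂ L) (_ : H.IsCartanSubalgebra)
    (φ : ι ≃ H.root) (e : ι → L),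
    (∀ i j, ∃ n : ℤ, Φ.pairing i j = n ∧
      (LieAlgebra.IsKilling.rootSystem H).pairing (φ i) (φ j) = n) ∧
    (∀ i, e i ∈ LieAlgebra.rootSpace H (φ i : LieModule.Weight ℂ H L)) ∧
    (∀ i j, Φ.root j = -Φ.root i →
      ⁅e i, e j⁆ = ((LieAlgebra.IsKilling.rootSystem H).coroot (φ i) : L)) ∧
    (∀ i j k, Φ.root k = Φ.root i + Φ.root j →
      (N i j = 1 ∨ N i j = -1) ∧ ⁅e i, e j⁆ = N i j • e k)

/-- An embedding of the root system `Ψ` into the root system `Φ`: an injective linear map of the ambient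
spaces which sends roots to roots and preserves the Cartan integers. -/
structure Embedding (Ψ : RootPairing κ ℝ W W') (Φ : RootPairing ι ℝ V V') where
  toLinear : W →ₗ[ℝ] V
  injective : Function.Injective toLinear
  toIndex : κ → ι
  root_toIndex : ∀ k, Φ.root (toIndex k) = toLinear (Ψ.root k)
  pairing_toIndex : ∀ k l, Φ.pairing (toIndex k) (toIndex l) = Ψ.pairing k l

/-- The restriction of the structure constants from `Φ` to a subsystem `Ψ`. -/
def Embedding.restrict {Ψ : RootPairing κ ℝ W W'} {Φ : RootPairing ι ℝ V V'}
    (f : Embedding Ψ Φ) (N : ι → ι → ℤ) : κ → κ → ℤ :=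
  fun k l => N (f.toIndex k) (f.toIndex l)

end RootSystems

section Steinberg

variable {ι V V' : Type*} [AddCommGroup V] [Module ℝ V] [AddCommGroup V'] [Module ℝ V']

/-- The defining relators of the Steinberg group of a simply-laced root system, in the free group
on the symbols `x_α(a)`. -/
inductive Relator (Φ : RootPairing ι ℝ V V') (N : ι → ι → ℤ) (R : Type*) [CommRing R] :
    FreeGroup (ι × R) → Prop
  | add (i : ι) (a b : R) : Relator Φ N R
      (FreeGroup.of (i, a) * FreeGroup.of (i, b) * (FreeGroup.of (i, a + b))⁻¹)
  | comm (i j k : ι) (a b : R) (h : Φ.root k = Φ.root i + Φ.root j) : Relator Φ N R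
      (FreeGroup.of (i, a) * FreeGroup.of (j, b) * (FreeGroup.of (i, a))⁻¹ *
        (FreeGroup.of (j, b))⁻¹ *
        (FreeGroup.of (k, (N i j : R) * (a * b)))⁻¹)
  | comm_one (i j : ι) (a b : R) (h : ∀ k, Φ.root k ≠ Φ.root i + Φ.root j)
      (h0 : Φ.root i + Φ.root j ≠ 0) : Relator Φ N R
      (FreeGroup.of (i, a) * FreeGroup.of (j, b) * (FreeGroup.of (i, a))⁻¹ *
        (FreeGroup.of (j, b))⁻¹)

/-- The Steinberg group `St(Φ, R)` (with respect to the structure constants `N`). -/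
abbrev St (Φ : RootPairing ι ℝ V V') (N : ι → ι → ℤ) (R : Type*) [CommRing R] : Type _ :=
  PresentedGroup {r : FreeGroup (ι × R) | Relator Φ N R r}

namespace St

variable {Φ : RootPairing ι ℝ V V'} {N : ι → ι → ℤ} {R S : Type*} [CommRing R] [CommRing S]

/-- The generator `x_α(a)`. -/
def x (Φ : RootPairing ι ℝ V V') (N : ι → ι → ℤ) {R : Type*} [CommRing R] (i : ι) (a : R) :
    St Φ N R :=
  PresentedGroup.of (i, a)

theorem x_add (i : ι) (a b : R) : x Φ N i a * x Φ N i b = x Φ N i (a + b) :=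
  PresentedGroup.mk_eq_mk_of_mul_inv_mem (Relator.add i a b)

theorem x_comm {i j k : ι} (h : Φ.root k = Φ.root i + Φ.root j) (a b : R) :
    x Φ N i a * x Φ N j b * (x Φ N i a)⁻¹ * (x Φ N j b)⁻¹ = x Φ N k ((N i j : R) * (a * b)) :=
  PresentedGroup.mk_eq_mk_of_mul_inv_mem (Relator.comm i j k a b h)

theorem x_comm_one {i j : ι} (h : ∀ k, Φ.root k ≠ Φ.root i + Φ.root j)
    (h0 : Φ.root i + Φ.root j ≠ 0) (a b : R) : x Φ N i a * x Φ N j b * (x Φ N i a)⁻¹ * (x Φ N j b)⁻¹ = 1 :=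
  PresentedGroup.one_of_mem (Relator.comm_one i j a b h h0)

/-- The homomorphism `St(Φ, R) → St(Φ, S)` induced by a ring homomorphism `R → S`. -/
def map (Φ : RootPairing ι ℝ V V') (N : ι → ι → ℤ) (f : R →+* S) : St Φ N R →* St Φ N S :=
  PresentedGroup.toGroup (f := fun p : ι × R => x Φ N p.1 (f p.2)) (by
    rintro r (⟨i, a, b⟩ | ⟨i, j, k, a, b, h⟩ | ⟨i, j, a, b, h, h0⟩)
    · simp [x_add]
    · simp [x_comm h]
    · simp [x_comm_one h h0])

variable {κ W W' : Type*} [AddCommGroup W] [Module ℝ W] [AddCommGroup W'] [Module ℝ W']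

theorem _root_.RelSteinberg.Embedding.exists_root_eq_add
    {Ψ : RootPairing κ ℝ W W'} {Φ : RootPairing ι ℝ V V'} (f : Embedding Ψ Φ)
    (hΦ : IsSimplyLaced Φ)
    {k l : κ} {m : ι}
    (h : Φ.root m = Φ.root (f.toIndex k) + Φ.root (f.toIndex l)) :
    ∃ n, Ψ.root n = Ψ.root k + Ψ.root l := by
  have key : Ψ.pairing k l = -1 := by
    rw [← f.pairing_toIndex]
    have h1 := RootPairing.pairing_eq_add_of_root_eq_add (l := m) h
    have h2 := RootPairing.pairing_eq_add_of_root_eq_add (l := f.toIndex k) h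
    have h3 := RootPairing.pairing_eq_add_of_root_eq_add (l := f.toIndex l) h
    rw [hΦ (f.toIndex k) m, hΦ (f.toIndex l) m, h2, h3, hΦ (f.toIndex l) (f.toIndex k)] at h1
    simp only [RootPairing.pairing_same] at h1
    linarith
  refine ⟨Ψ.reflectionPerm l k, ?_⟩
  rw [← Ψ.reflectionPerm_root]
  simp [key, sub_neg_eq_add]

/-- The homomorphism `j_R : St(Ψ, R) → St(Φ, R)`, `x_α(a) ↦ x_α(a)`, induced by an embedding
of root systems. -/
def ofEmbedding {Ψ : RootPairing κ ℝ W W'} {Φ : RootPairing ι ℝ V V'} (f : Embedding Ψ Φ)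
    (hΦ : IsSimplyLaced Φ)
    (N : ι → ι → ℤ) (R : Type*) [CommRing R] : St Ψ (f.restrict N) R →* St Φ N R :=
  PresentedGroup.toGroup (f := fun p : κ × R => x Φ N (f.toIndex p.1) p.2) (by
    rintro r (⟨i, a, b⟩ | ⟨i, j, k, a, b, h⟩ | ⟨i, j, a, b, h, h0⟩)
    · simp [x_add]
    · have h' : Φ.root (f.toIndex k) = Φ.root (f.toIndex i) + Φ.root (f.toIndex j) := by
        simp [f.root_toIndex, h]
      simp [x_comm h', Embedding.restrict]
    · simp only [map_mul, map_inv, FreeGroup.lift_apply_of]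
      refine x_comm_one (fun m hm => ?_) (fun h1 => ?_) a b
      · obtain ⟨n, hn⟩ := f.exists_root_eq_add hΦ hm
        exact h n hn
      · refine h0 (f.injective ?_)
        simpa [f.root_toIndex] using h1)

end St

/-- The double `R ×_{R/I} R` of a ring along an ideal: the pairs `(a, b)` with `a - b ∈ I`. -/
def doubleRing {R : Type*} [CommRing R] (I : Ideal R) : Subring (R × R) :=
  RingHom.eqLocus ((Ideal.Quotient.mk I).comp (RingHom.fst R R))
    ((Ideal.Quotient.mk I).comp (RingHom.snd R R))

namespace St

variable (Φ : RootPairing ι ℝ V V') (N : ι → ι → ℤ) {R : Type*} [CommRing R] (I : Ideal R)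

/-- The projection `p₁^* : St(Φ, R ×_{R/I} R) → St(Φ, R)`. -/
def p₁ : St Φ N (doubleRing I) →* St Φ N R :=
  map Φ N ((RingHom.fst R R).comp (doubleRing I).subtype)

/-- The projection `p₂^* : St(Φ, R ×_{R/I} R) → St(Φ, R)`. -/
def p₂ : St Φ N (doubleRing I) →* St Φ N R :=
  map Φ N ((RingHom.snd R R).comp (doubleRing I).subtype)

/-- The relative Steinberg group `St(Φ, R, I) = Ker(p₁^*) / [Ker(p₁^*), Ker(p₂^*)]`. -/
abbrev Rel : Type _ :=
  (p₁ Φ N I).ker ⧸ (⁅(p₁ Φ N I).ker, (p₂ Φ N I).ker⁆).subgroupOf (p₁ Φ N I).ker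

/-- The canonical homomorphism `μ : St(Φ, R, I) → St(Φ, R)` induced by `p₂^*`. -/
def Rel.μ : Rel Φ N I →* St Φ N R :=
  QuotientGroup.lift _ ((p₂ Φ N I).comp (p₁ Φ N I).ker.subtype) (by
    intro g hg
    exact Subgroup.commutator_le_right (p₁ Φ N I).ker (p₂ Φ N I).ker (Subgroup.mem_subgroupOf.mp hg))

end St

end Steinberg

end

end RelSteinberg

/-! The scheme is Quillen patching. Put s = `μ g`; it becomes trivial at X = 0, because the two
projections of the double ring agree modulo X. The elements a of A such that s(u + av) s(u)⁻¹ comes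
from the subsystem for all polynomials u, v form an ideal (`dilationIdeal`). If this ideal contains
1, then u = 0 and v = X show that s itself comes from the subsystem. So it suffices to find, for
each maximal ideal M, a member of the ideal outside M.

Such a member comes from a dilation principle (`exists_dilation_mem_range`) applied over A[Y] to s(Y
+ X) s(Y)⁻¹: if s(0) = 1 and the localization of s at S comes from the subsystem, then so does s(aX)
for some a in S.

To prove the dilation principle, let C' be the localization of A at S and let m be the non-unital
ring of combinations of powers T^q with q a positive rational and coefficients in C'[X]. The map f ↦
f(TX) - f(0) lifts to a homomorphism from St(C'[X]) to the semidirect product St(m) ⋊ St(C'). It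
sends the image of the subsystem to elements whose St(m)-component lies in the subgroup generated by
the root elements of the subsystem. Replacing T^q by s^(q k!), where s in S becomes more and more
divisible and k grows, clears denominators and maps m to germs of A[X]-valued functions. Thus St(m)
maps to germs of St(A[X])-valued functions, and the St(m)-component of the given element goes to the
family of its dilations. Almost all of them therefore come from the subsystem.

The delicate point is the action of St(C') on St(m). Conjugation by x_α(c) has an evident formula on
every root element except those of -α. It extends to these because a single root can be eliminated
from the presentation of St(m) (`exists_extension`): x_ν is recovered from the commutators [x_i,
x_j] with i + j = ν. This needs rank at least three, and it needs `HasRegularFactors` in place of a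
unit; the rational exponents provide the latter, since T^q is divisible by T^e for every e < q. -/

namespace RelSteinberg

/-! ### Combinatorics of simply-laced root systems. -/

set_option linter.unusedSectionVars false

open Module

/-- The combinatorial properties of a simply-laced irreducible root system of rank at least three
(with roots `r i` and Cartan integers `B i j`) on which the arguments below rely. -/
structure SimplyLacedForm {ι V : Type*} [AddCommGroup V] (r : ι → V) (B : ι → ι → ℤ) : Prop where
  injective : Function.Injective r
  self : ∀ i, B i i = 2
  symm : ∀ i j, B i j = B j i
  le_two : ∀ i j, B i j ≤ 2
  neg_two_le : ∀ i j, -2 ≤ B i j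
  eq_of_eq_two : ∀ {i j}, B i j = 2 → i = j
  eq_neg_two_iff : ∀ {i j}, B i j = -2 ↔ r i + r j = 0
  exists_add : ∀ {i j}, B i j = -1 → ∃ k, r k = r i + r j
  add_left : ∀ {i j k}, r k = r i + r j → ∀ l, B k l = B i l + B j l
  exists_neg : ∀ i, ∃ j, r j = -r i
  exists_split : ∀ k, ∃ i j, r k = r i + r j
  exists_cross : ∀ {i j k}, r k = r i + r j → ∃ l, B l i = 1 ∧ B l j = -1

namespace SimplyLacedForm

variable {ι V : Type*} [AddCommGroup V] {r : ι → V} {B : ι → ι → ℤ}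

theorem add_right (h : SimplyLacedForm r B) {i j k : ι} (hk : r k = r i + r j) (l : ι) :
    B l k = B l i + B l j := by
  rw [h.symm l k, h.symm l i, h.symm l j, h.add_left hk]

/-- Expanding `B k k` gives 2 = 4 + 2 `B i j`. -/
theorem eq_neg_one (h : SimplyLacedForm r B) {i j k : ι} (hk : r k = r i + r j) :
    B i j = -1 := by
  have h1 := h.add_left hk k
  have h2 := h.add_right hk i
  have h3 := h.add_right hk j
  have := h.self i
  have := h.self j
  have := h.self k
  have := h.symm i j
  omega

/-- Additivity is available only for sums of roots that are roots. With i = p + q it is applied to q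
= i + (-p) and to -p = (-i) + q. -/
theorem neg_left (h : SimplyLacedForm r B) {i j : ι} (hj : r j = -r i) (l : ι) :
    B j l = -B i l := by
  obtain ⟨p, q, hpq⟩ := h.exists_split i
  obtain ⟨p', hp'⟩ := h.exists_neg p
  have e2 : r q = r i + r p' := by rw [hp', hpq]; abel
  have e3 : r p' = r j + r q := by rw [hp', hj, hpq]; abel
  have := h.add_left e2 l
  have := h.add_left e3 l
  omega

theorem exists_sub (h : SimplyLacedForm r B) {i j : ι} (hij : B i j = 1) :
    ∃ k, r i = r j + r k := by
  obtain ⟨j', hj'⟩ := h.exists_neg j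
  have h1 : B i j' = -1 := by rw [h.symm, h.neg_left hj', h.symm, hij]
  obtain ⟨k, hk⟩ := h.exists_add h1
  exact ⟨k, by rw [hk, hj']; abel⟩

end SimplyLacedForm

section RootPairing

variable {ι V V' : Type*} [AddCommGroup V] [Module ℝ V] [AddCommGroup V'] [Module ℝ V']
  [Finite ι] (Φ : RootPairing ι ℝ V V') [Φ.IsRootSystem] [Φ.IsCrystallographic] [Φ.IsReduced]

theorem pairingIn_comm_of_isSimplyLaced (hΦ : IsSimplyLaced Φ) (i j : ι) :
    Φ.pairingIn ℤ i j = Φ.pairingIn ℤ j i := by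
  have := hΦ i j
  rw [← Φ.algebraMap_pairingIn ℤ, ← Φ.algebraMap_pairingIn ℤ] at this
  exact_mod_cast this

theorem abs_pairingIn_le_one_of_isSimplyLaced (hΦ : IsSimplyLaced Φ) {i j : ι}
    (h : Φ.root i ≠ Φ.root j) (h' : Φ.root i ≠ -Φ.root j) : |Φ.pairingIn ℤ i j| ≤ 1 := by
  have h1 := Φ.pairingIn_pairingIn_mem_set_of_isCrystal_of_isRed' i j h h'
  have h2 := pairingIn_comm_of_isSimplyLaced Φ hΦ i j
  simp only [Set.mem_insert_iff, Set.mem_singleton_iff, Prod.mk.injEq] at h1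
  rw [abs_le]
  omega

theorem root_reflectionPerm_eq_add {i j : ι} (h : Φ.pairingIn ℤ i j = -1) :
    Φ.root (Φ.reflectionPerm j i) = Φ.root i + Φ.root j := by
  have h1 : Φ.pairing i j = -1 := by
    rw [← Φ.algebraMap_pairingIn ℤ, h]; simp
  rw [← Φ.reflectionPerm_root, Φ.root_coroot_eq_pairing, h1]
  simp

theorem root_reflectionPerm_self_eq_neg (i : ι) :
    Φ.root (Φ.reflectionPerm i i) = -Φ.root i := by
  rw [← Φ.reflectionPerm_root, Φ.root_coroot_eq_pairing, Φ.pairing_same]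
  module

theorem pairingIn_eq_neg_of_root_eq_neg {i j : ι} (h : Φ.root j = -Φ.root i) (l : ι) :
    Φ.pairingIn ℤ j l = -Φ.pairingIn ℤ i l := by
  have : Φ.pairing j l = -Φ.pairing i l := by
    rw [← Φ.root_coroot_eq_pairing, ← Φ.root_coroot_eq_pairing, h]; simp
  rw [← Φ.algebraMap_pairingIn ℤ, ← Φ.algebraMap_pairingIn ℤ] at this
  exact_mod_cast this

/-- A proper subspace containing a root does not contain, up to orthogonality, all roots. -/
theorem exists_root_notMem_of_ne_top [Φ.IsIrreducible] (q : Submodule ℝ V) (hq : q ≠ ⊤)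
    (s : Set ι) (hs : s.Nonempty) (hsq : q = Submodule.span ℝ (Φ.root '' s)) :
    ∃ l, Φ.root l ∉ q ∧ ∃ i ∈ s, Φ.pairingIn ℤ i l ≠ 0 := by
  by_contra! hcon
  -- If all roots outside q were orthogonal to s, then q would be stable under every reflection,
  -- against irreducibility.
  refine hq (RootPairing.IsIrreducible.eq_top_of_invtSubmodule_reflection (P := Φ) q ?_ ?_)
  · intro l
    rw [Module.End.mem_invtSubmodule]
    by_cases hl : Φ.root l ∈ q
    · intro v hv
      rw [Submodule.mem_comap]
      change Φ.reflection l v ∈ q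
      rw [Φ.reflection_apply]
      exact q.sub_mem hv (q.smul_mem _ hl)
    · conv_lhs => rw [hsq]
      rw [Submodule.span_le]
      rintro _ ⟨i, hi, rfl⟩
      have h0 : Φ.pairing i l = 0 := by
        rw [← Φ.algebraMap_pairingIn ℤ, hcon l hl i hi]; simp
      change Φ.reflection l (Φ.root i) ∈ q
      rw [Φ.reflection_apply, Φ.root_coroot'_eq_pairing, h0, zero_smul, sub_zero, hsq]
      exact Submodule.subset_span ⟨i, hi, rfl⟩
  · obtain ⟨i, hi⟩ := hs
    intro h
    have : Φ.root i ∈ q := by rw [hsq]; exact Submodule.subset_span ⟨i, hi, rfl⟩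
    rw [h, Submodule.mem_bot] at this
    exact Φ.ne_zero i this

theorem span_root_ne_top_of_card_lt (hrank : 3 ≤ Module.finrank ℝ V) (i j : ι) :
    Submodule.span ℝ (Φ.root '' {i, j}) ≠ ⊤ := by
  intro h
  have h1 : Module.finrank ℝ (Submodule.span ℝ (Φ.root '' ({i, j} : Set ι))) ≤ 2 := by
    classical
    have : Φ.root '' {i, j} = (({Φ.root i, Φ.root j} : Finset V) : Set V) := by
      simp [Set.image_pair]
    rw [this]
    exact (finrank_span_finset_le_card _).trans Finset.card_le_two
  rw [h, finrank_top] at h1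
  omega

theorem simplyLacedForm_pairingIn [Φ.IsIrreducible] (hΦ : IsSimplyLaced Φ)
    (hrank : 3 ≤ Module.finrank ℝ V) :
    SimplyLacedForm Φ.root (Φ.pairingIn ℤ) := by
  have hsymm := pairingIn_comm_of_isSimplyLaced Φ hΦ
  have htwo : ∀ {i j}, Φ.root i = Φ.root j → Φ.pairingIn ℤ i j = 2 := by
    intro i j h
    rw [Φ.root.injective h, Φ.pairingIn_same]
  have hnegtwo : ∀ {i j}, Φ.root i = -Φ.root j → Φ.pairingIn ℤ i j = -2 := fun {i j} h =>
    ((Φ.pairingIn_neg_two_neg_two_iff ℤ i j).2 h).1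
  have hadd : ∀ {i j}, Φ.pairingIn ℤ i j = -1 → ∃ k, Φ.root k = Φ.root i + Φ.root j :=
    fun h => ⟨_, root_reflectionPerm_eq_add Φ h⟩
  have hadd_left : ∀ {i j k}, Φ.root k = Φ.root i + Φ.root j →
      ∀ l, Φ.pairingIn ℤ k l = Φ.pairingIn ℤ i l + Φ.pairingIn ℤ j l :=
    fun h l => RootPairing.pairingIn_eq_add_of_root_eq_add h
  have hneg : ∀ i, ∃ j, Φ.root j = -Φ.root i := fun i => ⟨_, root_reflectionPerm_self_eq_neg Φ i⟩
  have hone : ∀ {i j}, Φ.root i ≠ Φ.root j → Φ.root i ≠ -Φ.root j →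
      -1 ≤ Φ.pairingIn ℤ i j ∧ Φ.pairingIn ℤ i j ≤ 1 := fun h h' =>
    abs_le.1 (abs_pairingIn_le_one_of_isSimplyLaced Φ hΦ h h')
  have hbound : ∀ i j, -2 ≤ Φ.pairingIn ℤ i j ∧ Φ.pairingIn ℤ i j ≤ 2 := by
    intro i j
    by_cases h1 : Φ.root i = Φ.root j
    · rw [htwo h1]; omega
    by_cases h2 : Φ.root i = -Φ.root j
    · rw [hnegtwo h2]; omega
    have := hone h1 h2
    omega
  refine ⟨Φ.root.injective, Φ.pairingIn_same ℤ, hsymm, fun i j => (hbound i j).2,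
    fun i j => (hbound i j).1, fun {i j} h => ?_, fun {i j} => ?_, hadd, hadd_left, hneg,
    fun k => ?_, fun {i j k} hk => ?_⟩
  · exact (Φ.pairingIn_two_two_iff ℤ i j).1 ⟨h, by rw [hsymm, h]⟩
  · rw [← eq_neg_iff_add_eq_zero, ← Φ.pairingIn_neg_two_neg_two_iff ℤ, hsymm j i, and_self]
  -- A root l off the line of k and not orthogonal to k pairs to ±1 with it, so k + l or k - l is a
  -- root.
  · obtain ⟨l, hl, i, hi, h0⟩ := exists_root_notMem_of_ne_top Φ
      (Submodule.span ℝ (Φ.root '' {k, k})) (span_root_ne_top_of_card_lt Φ hrank k k) {k, k}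
      ⟨k, by simp⟩ rfl
    obtain rfl : i = k := by simpa using hi
    have hmem : Φ.root i ∈ Submodule.span ℝ (Φ.root '' {i, i}) :=
      Submodule.subset_span ⟨i, by simp, rfl⟩
    have h1 := hone (i := i) (j := l) (fun h => hl (h ▸ hmem))
      (fun h => hl (by rw [← neg_eq_iff_eq_neg.2 h]; exact neg_mem hmem))
    obtain ⟨l', hl'⟩ := hneg l
    have h2 := pairingIn_eq_neg_of_root_eq_neg Φ hl' i
    rw [hsymm l' i, hsymm l i] at h2
    by_cases h3 : Φ.pairingIn ℤ i l = -1
    · obtain ⟨p, hp⟩ := hadd h3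
      exact ⟨p, l', by rw [hp, hl']; abel⟩
    · obtain ⟨p, hp⟩ := hadd (i := i) (j := l') (by omega)
      exact ⟨p, l, by rw [hp, hl']; abel⟩
  -- Rank three provides a root l off the plane of i and j and not orthogonal to it. Its products
  -- with i, j and k = i + j lie in {-1, 0, 1}. Up to sign the pair of products with i and j is (1,
  -- -1), (1, 0) or (0, 1); the last two are moved to (1, -1) by passing to i - l and l - j.
  · obtain ⟨l, hl, m, hm, h0⟩ := exists_root_notMem_of_ne_top Φ
      (Submodule.span ℝ (Φ.root '' {i, j})) (span_root_ne_top_of_card_lt Φ hrank i j) {i, j}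
      ⟨i, by simp⟩ rfl
    have hi : Φ.root i ∈ Submodule.span ℝ (Φ.root '' {i, j}) :=
      Submodule.subset_span ⟨i, by simp, rfl⟩
    have hj : Φ.root j ∈ Submodule.span ℝ (Φ.root '' {i, j}) :=
      Submodule.subset_span ⟨j, by simp, rfl⟩
    have key : ∀ m, Φ.root m ∈ Submodule.span ℝ (Φ.root '' {i, j}) →
        -1 ≤ Φ.pairingIn ℤ l m ∧ Φ.pairingIn ℤ l m ≤ 1 := fun m hm =>
      hone (fun h => hl (h ▸ hm)) (fun h => hl (by rw [h]; exact neg_mem hm))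
    have h1 := key i hi
    have h2 := key j hj
    have h3 := key k (by rw [hk]; exact add_mem hi hj)
    have h4 := hadd_left hk l
    rw [hsymm k l, hsymm i l, hsymm j l] at h4
    have h5 : Φ.pairingIn ℤ l i ≠ 0 ∨ Φ.pairingIn ℤ l j ≠ 0 := by
      rw [hsymm m l] at h0
      obtain rfl | rfl : m = i ∨ m = j := by simpa using hm
      exacts [Or.inl h0, Or.inr h0]
    obtain ⟨l', hl'⟩ := hneg l
    have h6 := pairingIn_eq_neg_of_root_eq_neg Φ hl'
    have hi2 := Φ.pairingIn_same ℤ i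
    have hj2 := Φ.pairingIn_same ℤ j
    have hij : Φ.pairingIn ℤ i j = -1 := by
      have := hadd_left hk k
      rw [hsymm i k, hsymm j k, hadd_left hk i, hadd_left hk j, Φ.pairingIn_same ℤ,
        Φ.pairingIn_same ℤ, Φ.pairingIn_same ℤ, hsymm j i] at this
      omega
    have hji := hsymm i j
    have aux : ∀ p t : ι, Φ.pairingIn ℤ p t = -1 → Φ.pairingIn ℤ p i + Φ.pairingIn ℤ t i = 1 →
        Φ.pairingIn ℤ p j + Φ.pairingIn ℤ t j = -1 →
        ∃ l, Φ.pairingIn ℤ l i = 1 ∧ Φ.pairingIn ℤ l j = -1 := by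
      intro p t hpt e1 e2
      obtain ⟨v, hv⟩ := hadd hpt
      exact ⟨v, by rw [hadd_left hv]; exact e1, by rw [hadd_left hv]; exact e2⟩
    have h6i := h6 i
    have h6j := h6 j
    by_cases c1 : Φ.pairingIn ℤ l i = 1 ∧ Φ.pairingIn ℤ l j = -1
    · exact ⟨l, c1⟩
    by_cases c2 : Φ.pairingIn ℤ l i = -1 ∧ Φ.pairingIn ℤ l j = 1
    · exact ⟨l', by omega, by omega⟩
    by_cases c3 : Φ.pairingIn ℤ l i = 1
    · exact aux l' i (by omega) (by omega) (by omega)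
    by_cases c4 : Φ.pairingIn ℤ l i = -1
    · exact aux l i (by omega) (by omega) (by omega)
    obtain ⟨j', hj'⟩ := hneg j
    have h7 := pairingIn_eq_neg_of_root_eq_neg Φ hj'
    have h7i := h7 i
    have h7j := h7 j
    have h7l := h7 l
    rw [hsymm j' l, hsymm j l] at h7l
    by_cases c5 : Φ.pairingIn ℤ l j = 1
    · exact aux l j' (by omega) (by omega) (by omega)
    · have h8 := h6 j'
      exact aux l' j' (by omega) (by omega) (by omega)

end RootPairing

end RelSteinberg

/-! ### Identities between the structure constants. -/

namespace RelSteinberg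

/-- The identities between the structure constants on which the arguments below rely. -/
structure StructureConstants {ι V : Type*} [AddCommGroup V] (r : ι → V) (B : ι → ι → ℤ)
    (N : ι → ι → ℤ) : Prop where
  mul_self : ∀ {i j k}, r k = r i + r j → N i j * N i j = 1
  antisymm : ∀ {i j k}, r k = r i + r j → N j i = -N i j
  jacobi : ∀ {a b c ab bc n}, r ab = r a + r b → r bc = r b + r c → r n = r ab + r c →
    B a c = 0 → N a b * N ab c = N b c * N a bc

section

variable {ι V V' : Type*} [AddCommGroup V] [Module ℝ V] [AddCommGroup V'] [Module ℝ V']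
  [Finite ι] (Φ : RootPairing ι ℝ V V') [Φ.IsRootSystem] [Φ.IsCrystallographic] [Φ.IsReduced]

/-- Root vectors of orthogonal roots commute, so when a and c are orthogonal the Jacobi identity for
`e a`, `e b`, `e c` has only two nonzero terms. -/
theorem structureConstants_of_isStructureConstants (hΦ : IsSimplyLaced Φ) (N : ι → ι → ℤ)
    (hN : IsStructureConstants Φ N) : StructureConstants Φ.root (Φ.pairingIn ℤ) N := by
  obtain ⟨L, _, _, _, _, H, _, φ, e, hpair, hmem, hcoroot, hlie⟩ := hN
  set P := LieAlgebra.IsKilling.rootSystem H with hP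
  have hp : ∀ i j, P.pairing (φ i) (φ j) = (Φ.pairingIn ℤ i j : ℂ) := by
    intro i j
    obtain ⟨n, h1, h2⟩ := hpair i j
    rw [h2, ← Φ.algebraMap_pairingIn ℤ] at *
    have : Φ.pairingIn ℤ i j = n := by
      have h3 : ((Φ.pairingIn ℤ i j : ℤ) : ℝ) = n := h1
      exact_mod_cast h3
    rw [this]
  have hsymm := pairingIn_comm_of_isSimplyLaced Φ hΦ
  have hne : ∀ i, e i ≠ 0 := by
    intro i h0
    have h1 := hcoroot i _ (root_reflectionPerm_self_eq_neg Φ i)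
    rw [h0, zero_lie] at h1
    have h2 : P.coroot (φ i) = 0 := by
      rw [LieAlgebra.IsKilling.rootSystem_coroot_apply]
      exact Subtype.ext h1.symm
    have h3 : P.pairing (φ i) (φ i) = 0 := by
      rw [← P.root_coroot_eq_pairing, h2]; simp
    rw [hp, Φ.pairingIn_same] at h3
    norm_num at h3
  -- A nonzero bracket would make a + c a weight. It is nonzero, as it takes the value 2 on the
  -- coroot of a, so it would be a root k; its products with a and c would be 2 each, giving 4
  -- instead of 2 for its product with itself.
  have hzero : ∀ a c, Φ.pairingIn ℤ a c = 0 → ⁅e a, e c⁆ = 0 := by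
    intro a c h0
    by_contra hcon
    have h1 := LieAlgebra.lie_mem_genWeightSpace_of_mem_genWeightSpace (hmem a) (hmem c)
    set χ : H → ℂ := ((φ a : LieModule.Weight ℂ H L) : H → ℂ) + (φ c : LieModule.Weight ℂ H L)
    have h2 : LieModule.genWeightSpace L χ ≠ ⊥ := by
      intro h2
      rw [h2] at h1
      exact hcon ((LieSubmodule.mem_bot _).1 h1)
    let w : LieModule.Weight ℂ H L := ⟨χ, h2⟩
    have hpl : ∀ l, (w : H → ℂ) (P.coroot (φ l)) =
        ((Φ.pairingIn ℤ a l + Φ.pairingIn ℤ c l : ℤ) : ℂ) := by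
      intro l
      push_cast
      rw [← hp, ← hp]
      rfl
    by_cases hw : w.IsZero
    · have h3 := hpl a
      rw [show (w : H → ℂ) = 0 from hw, hsymm c a, h0, Φ.pairingIn_same] at h3
      norm_num at h3
    · have hwm : w ∈ LieSubalgebra.root := by simpa [LieSubalgebra.root] using hw
      obtain ⟨k, hk⟩ := φ.surjective ⟨w, hwm⟩
      have hkl : ∀ l, Φ.pairingIn ℤ k l = Φ.pairingIn ℤ a l + Φ.pairingIn ℤ c l := by
        intro l
        have h3 := hp k l
        rw [hk, ← P.root_coroot_eq_pairing] at h3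
        have h4 := hpl l
        have h5 : P.toLinearMap (P.root ⟨w, hwm⟩) (P.coroot (φ l)) =
          (w : H → ℂ) (P.coroot (φ l)) := rfl
        rw [h5, h4] at h3
        exact_mod_cast h3.symm
      have e1 := hkl k
      have e2 := hkl a
      have e3 := hkl c
      rw [Φ.pairingIn_same] at e1 e2 e3
      have := hsymm a k
      have := hsymm c k
      have := hsymm a c
      omega
  have hcancel : ∀ (i : ι) (m n : ℤ), m • e i = n • e i → m = n := by
    intro i m n h
    rw [← sub_eq_zero, ← sub_smul, ← Int.cast_smul_eq_zsmul ℂ, smul_eq_zero] at h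
    rcases h with h | h
    · have : m - n = 0 := by exact_mod_cast h
      omega
    · exact absurd h (hne i)
  refine ⟨fun {i j k} h => ?_, fun {i j k} h => ?_, fun {a b c ab bc n} h1 h2 h3 h4 => ?_⟩
  · rcases (hlie i j k h).1 with h | h <;> simp [h]
  · apply hcancel k
    rw [← (hlie j i k (by rw [h, add_comm])).2, neg_smul, ← (hlie i j k h).2, lie_skew]
  · apply hcancel n
    have h5 : Φ.root n = Φ.root a + Φ.root bc := by rw [h3, h1, h2]; abel
    have h6 := leibniz_lie (e a) (e b) (e c)
    rw [hzero a c h4, lie_zero, add_zero, (hlie a b ab h1).2, (hlie b c bc h2).2, lie_zsmul,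
      zsmul_lie, (hlie ab c n h3).2, (hlie a bc n h5).2] at h6
    rw [mul_smul, mul_smul, h6]

end

end RelSteinberg

/-! ### Elimination of a root from the Steinberg relations. -/

namespace RelSteinberg

open scoped commutatorElement

section GroupIdentities

variable {G : Type*} [Group G] {a b c d y z : G}

theorem commute_commutator (h1 : Commute d a) (h2 : Commute d b) : Commute d ⁅a, b⁆ := by
  rw [commutatorElement_def]
  exact ((h1.mul_right h2).mul_right h1.inv_right).mul_right h2.inv_right

theorem commutator_eq_iff : ⁅a, b⁆ = c ↔ a * b = c * b * a := by
  rw [commutatorElement_def, mul_inv_eq_iff_eq_mul, mul_inv_eq_iff_eq_mul]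

/-- Conjugation by d turns [b, c] into [b, zc], and z is invisible because it commutes with b and c.
-/
theorem commute_commutator_of_cross (h1 : Commute d b) (h2 : ⁅d, c⁆ = z) (h3 : Commute z b)
    (h4 : Commute z c) : Commute d ⁅b, c⁆ := by
  have h5 : d * c = z * c * d := commutator_eq_iff.1 h2
  have h6 : d * ⁅b, c⁆ * d⁻¹ = ⁅b, z * c⁆ := by
    have e1 : b = d * b * d⁻¹ := by rw [h1.eq]; group
    have e2 : z * c = d * c * d⁻¹ := by rw [h5]; group
    rw [e2]
    nth_rw 2 [e1]
    simp only [commutatorElement_def]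
    group
  have h7 : ⁅b, z * c⁆ = ⁅b, c⁆ := by
    have e1 : ⁅b, z * c⁆ = z * ⁅b, c⁆ * z⁻¹ := by
      simp only [commutatorElement_def, mul_inv_rev]
      rw [← mul_assoc b z c, ← h3.eq]
      group
    rw [e1, (commute_commutator h3 h4).eq]
    group
  rw [h7] at h6
  exact mul_inv_eq_iff_eq_mul.1 h6

theorem commutator_mul_left_of_commute (h1 : Commute a ⁅b, c⁆) :
    ⁅a * b, c⁆ = ⁅b, c⁆ * ⁅a, c⁆ := by
  have : ⁅a * b, c⁆ = a * ⁅b, c⁆ * a⁻¹ * ⁅a, c⁆ := by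
    simp only [commutatorElement_def]; group
  rw [this, h1.eq]; group

theorem commutator_mul_right_of_commute (h1 : Commute b ⁅a, c⁆) :
    ⁅a, b * c⁆ = ⁅a, b⁆ * ⁅a, c⁆ := by
  have : ⁅a, b * c⁆ = ⁅a, b⁆ * (b * ⁅a, c⁆ * b⁻¹) := by
    simp only [commutatorElement_def]; group
  rw [this, h1.eq]; group

theorem commutator_inv_right_of_commute (h : Commute y ⁅a, y⁆) : ⁅a, y⁻¹⁆ = ⁅a, y⁆⁻¹ := by
  have : ⁅a, y⁻¹⁆ = y⁻¹ * ⁅a, y⁆⁻¹ * y := by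
    simp only [commutatorElement_def]; group
  rw [this, (h.inv_left.inv_right).eq]; group

/-- A degenerate Hall–Witt identity: conjugation by c fixes a and sends b to y⁻¹b. -/
theorem commutator_commutator_of_commute (h1 : Commute a c) (h2 : ⁅b, c⁆ = y)
    (h3 : Commute y ⁅a, b⁆) (h4 : Commute y ⁅a, y⁆) : ⁅⁅a, b⁆, c⁆ = ⁅a, y⁆ := by
  have e1 : c * ⁅a, b⁆ * c⁻¹ = ⁅a, y⁻¹ * b⁆ := by
    have e2 : y⁻¹ * b = c * b * c⁻¹ := by
      rw [← h2]; simp only [commutatorElement_def]; group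
    have e3 : a = c * a * c⁻¹ := by rw [← h1.eq]; group
    rw [e2]
    nth_rw 2 [e3]
    simp only [commutatorElement_def]
    group
  rw [commutator_mul_right_of_commute h3.inv_left, commutator_inv_right_of_commute h4] at e1
  have e2 : ⁅⁅a, b⁆, c⁆ = ⁅a, b⁆ * (c * ⁅a, b⁆ * c⁻¹)⁻¹ := by
    rw [commutatorElement_def ⁅a, b⁆ c]; group
  rw [e2, e1]
  group

end GroupIdentities

/-- Any two elements have a common left factor that can be cancelled. -/
def HasRegularFactors (m : Type*) [NonUnitalCommRing m] : Prop :=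
  ∀ p q : m, ∃ t p' q' : m, (∀ a b, t * a = t * b → a = b) ∧ p = t * p' ∧ q = t * q'

theorem HasRegularFactors.exists_mul {m : Type*} [NonUnitalCommRing m] (hm : HasRegularFactors m)
    (p : m) : ∃ t p', p = t * p' := by
  obtain ⟨t, p', q', -, h, -⟩ := hm p p
  exact ⟨t, p', h⟩

/-- The elements `x i p` satisfy those Steinberg relations that involve only roots from `P`. -/
structure IsSteinbergOn {ι V m G : Type*} [AddCommGroup V] [NonUnitalCommRing m] [Group G]
    (r : ι → V) (B N : ι → ι → ℤ) (P : ι → Prop) (x : ι → m → G) : Prop where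
  map_add : ∀ {i}, P i → ∀ p q, x i (p + q) = x i p * x i q
  comm : ∀ {i j k}, P i → P j → P k → r k = r i + r j →
    ∀ p q, ⁅x i p, x j q⁆ = x k (N i j • (p * q))
  commute : ∀ {i j}, P i → P j → 0 ≤ B i j → ∀ p q, Commute (x i p) (x j q)

section Extension

variable {ι V m G : Type*} [AddCommGroup V] [NonUnitalCommRing m] [Group G]
  {r : ι → V} {B N : ι → ι → ℤ} {x : ι → m → G} {ν : ι}

theorem StructureConstants.smul_smul_self (hN : StructureConstants r B N) {i j k : ι}
    (h : r k = r i + r j) (p : m) : N i j • N i j • p = p := by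
  rw [smul_smul, hN.mul_self h, one_smul]

/-- A root having scalar product one with `k` is a summand of a decomposition `k = i + j` to both
members of which it has a nonnegative scalar product. -/
theorem SimplyLacedForm.exists_split_of_eq_one (h : SimplyLacedForm r B) {l k : ι}
    (hlk : B l k = 1) : ∃ i j, r k = r i + r j ∧ B l i = 1 ∧ B l j = 0 := by
  obtain ⟨j', hj'⟩ := h.exists_sub (i := k) (j := l) (by rw [h.symm, hlk])
  obtain ⟨e, he1, he2⟩ := h.exists_cross hj'
  obtain ⟨i, hi⟩ := h.exists_sub (i := l) (j := e) (by rw [h.symm, he1])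
  obtain ⟨j, hj⟩ := h.exists_add he2
  refine ⟨i, j, by rw [hj', hi, hj]; abel, ?_, ?_⟩
  · have := h.add_right hi l
    have := h.self l
    have := h.symm l e
    omega
  · have := h.add_right hj l
    have := h.symm l e
    have := h.eq_neg_one hj'
    omega

namespace IsSteinbergOn

variable (h : SimplyLacedForm r B) (hN : StructureConstants r B N) (hm : HasRegularFactors m)
  (hx : IsSteinbergOn r B N (· ≠ ν) x)

-- With t = l + j, the element x_l commutes with x_i, and [x_l, x_j] lies in the root subgroup of t,
-- which commutes with x_i and x_j. No relation for ν is used.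
include h hx in
theorem commute_of_cross {i j l : ι} (hν : r ν = r i + r j) (hi : B l i = 1) (hj : B l j = -1)
    (s p q : m) : Commute (x l s) ⁅x i p, x j q⁆ := by
  obtain ⟨t, ht⟩ := h.exists_add hj
  have e0 := h.eq_neg_one hν
  have e1 := h.add_right hν l
  have e2 := h.add_right hν i
  have e3 := h.add_right hν j
  have e4 := h.add_left ht ν
  have e5 := h.add_left ht i
  have e6 := h.add_left ht j
  have e7 := h.self i
  have e8 := h.self j
  have e9 := h.self ν
  have e10 := h.symm i j
  have hlν : l ≠ ν := by rintro rfl; omega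
  have hiν : i ≠ ν := by rintro rfl; omega
  have hjν : j ≠ ν := by rintro rfl; omega
  have htν : t ≠ ν := by rintro rfl; omega
  exact commute_commutator_of_cross (hx.commute hlν hiν (by omega) _ _)
    (hx.comm hlν hjν htν ht s q) (hx.commute htν hiν (by omega) _ _)
    (hx.commute htν hjν (by omega) _ _)

-- Choose l as in `exists_cross` and write i = l + k. Then x_i(s) is a commutator of an x_l, which
-- commutes with [x_i, x_j] by `commute_of_cross`, and an x_k, which commutes with both x_i and x_j.
include h hN hm hx in
theorem commute_left_commutator {i j : ι} (hν : r ν = r i + r j) (s p q : m) :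
    Commute (x i s) ⁅x i p, x j q⁆ := by
  obtain ⟨l, hl1, hl2⟩ := h.exists_cross hν
  obtain ⟨k, hk⟩ := h.exists_sub (i := i) (j := l) (by rw [h.symm, hl1])
  obtain ⟨s₁, s₂, rfl⟩ := hm.exists_mul s
  have e0 := h.eq_neg_one hν
  have e1 := h.add_right hν l
  have e2 := h.add_right hν i
  have e3 := h.add_right hν j
  have e4 := h.add_left hk ν
  have e5 := h.add_left hk i
  have e6 := h.add_left hk j
  have e7 := h.self i
  have e8 := h.self j
  have e9 := h.self ν
  have e10 := h.symm i j
  have hlν : l ≠ ν := by rintro rfl; omega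
  have hiν : i ≠ ν := by rintro rfl; omega
  have hjν : j ≠ ν := by rintro rfl; omega
  have hkν : k ≠ ν := by rintro rfl; omega
  have h1 : x i (s₁ * s₂) = ⁅x l (N l k • s₁), x k s₂⁆ := by
    rw [hx.comm hlν hkν hiν hk, smul_mul_assoc, hN.smul_smul_self hk]
  rw [h1]
  refine (commute_commutator (hx.commute_of_cross h hν hl1 hl2 _ _ _).symm
    (commute_commutator ?_ ?_).symm).symm
  · exact hx.commute hkν hiν (by omega) _ _
  · exact hx.commute hkν hjν (by omega) _ _

include h hN hm hx in
theorem commute_right_commutator {i j : ι} (hν : r ν = r i + r j) (s p q : m) :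
    Commute (x j s) ⁅x i p, x j q⁆ := by
  rw [← commutatorElement_inv]
  exact (hx.commute_left_commutator h hN hm (by rw [hν, add_comm]) s q p).inv_right

include h in
theorem _root_.RelSteinberg.SimplyLacedForm.ne_of_add {i j : ι} (hν : r ν = r i + r j) :
    i ≠ ν ∧ j ≠ ν := by
  have e0 := h.eq_neg_one hν
  have e2 := h.add_right hν i
  have e3 := h.add_right hν j
  have e7 := h.self i
  have e8 := h.self j
  have e9 := h.symm i j
  constructor <;> rintro rfl <;> omega

include h hN hm hx in
theorem commutator_add_right {i j : ι} (hν : r ν = r i + r j) (p q q' : m) :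
    ⁅x i p, x j (q + q')⁆ = ⁅x i p, x j q⁆ * ⁅x i p, x j q'⁆ := by
  rw [hx.map_add (h.ne_of_add hν).2,
    commutator_mul_right_of_commute (hx.commute_right_commutator h hN hm hν _ _ _)]

-- Both sides are triple commutators of x_k, x_l and x_j, bracketed in the two possible ways. They
-- agree because x_k and x_j commute.
include h hN hx hm in
theorem commutator_shift {i j k l t : ι} (hν : r ν = r i + r j) (hi : r i = r k + r l)
    (ht : r t = r l + r j) (p s q : m) :
    ⁅x i (N k l • (p * s)), x j q⁆ = ⁅x k p, x t (N l j • (s * q))⁆ := by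
  have hν' : r ν = r k + r t := by rw [hν, hi, ht]; abel
  have e0 := h.eq_neg_one hν
  have e1 := h.eq_neg_one hi
  have e2 := h.eq_neg_one ht
  have e3 := h.add_left hi j
  have e4 := h.add_right hν l
  have e5 := h.add_right hi l
  have e6 := h.add_left ht i
  have e7 := h.symm l k
  have e8 := h.self l
  have e9 := h.symm l i
  have e10 := h.symm i j
  have e11 := h.self ν
  have hlν : l ≠ ν := by rintro rfl; omega
  obtain ⟨hiν, hjν⟩ := h.ne_of_add hν
  obtain ⟨hkν, htν⟩ := h.ne_of_add hν'
  have h1 := hx.comm hkν hlν hiν hi p s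
  rw [← h1]
  refine commutator_commutator_of_commute (hx.commute hkν hjν (by omega) _ _)
    (hx.comm hlν hjν htν ht s q) ?_ (hx.commute_right_commutator h hN hm hν' _ _ _)
  rw [h1]
  exact hx.commute htν hiν (by omega) _ _

-- Factor the first argument as pu and move us, respectively u, across by `commutator_shift`: both
-- sides become the same commutator of x_k and x_t.
include h hN hx hm in
theorem commutator_mul_shift {i j : ι} (hν : r ν = r i + r j) (p s q : m) :
    ⁅x i (p * s), x j q⁆ = ⁅x i p, x j (s * q)⁆ := by
  obtain ⟨l, hl1, hl2⟩ := h.exists_cross hν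
  obtain ⟨k, hk⟩ := h.exists_sub (i := i) (j := l) (by rw [h.symm, hl1])
  obtain ⟨t, ht⟩ := h.exists_add hl2
  have hk' : r i = r k + r l := by rw [hk, add_comm]
  obtain ⟨p, u, rfl⟩ := hm.exists_mul p
  have h1 := hx.commutator_shift h hN hm hν hk' ht (N k l • p) (u * s) q
  have h2 := hx.commutator_shift h hN hm hν hk' ht (N k l • p) u (s * q)
  rw [smul_mul_assoc, hN.smul_smul_self hk'] at h1 h2
  rw [mul_assoc, h1, h2, mul_assoc]

-- A common regular factor t of p and p' stays on the left while the cofactors move to the right;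
-- cancelling t makes the right arguments equal.
include h hN hx hm in
theorem commutator_eq_of_mul_eq {i j : ι} (hν : r ν = r i + r j) {p q p' q' : m}
    (hpq : p * q = p' * q') : ⁅x i p, x j q⁆ = ⁅x i p', x j q'⁆ := by
  obtain ⟨t, u, v, ht, rfl, rfl⟩ := hm p p'
  rw [hx.commutator_mul_shift h hN hm hν, hx.commutator_mul_shift h hN hm hν,
    ht (u * q) (v * q') (by rw [← mul_assoc, hpq, mul_assoc])]

include h hN hx hm in
theorem exists_commutator_eq {i j : ι} (hν : r ν = r i + r j) :
    ∃ F : m → G, (∀ p q, F (p + q) = F p * F q) ∧ ∀ p q, ⁅x i p, x j q⁆ = F (p * q) := by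
  choose f g hfg using hm.exists_mul
  have key : ∀ p q, ⁅x i p, x j q⁆ = ⁅x i (f (p * q)), x j (g (p * q))⁆ := fun p q =>
    hx.commutator_eq_of_mul_eq h hN hm hν (hfg (p * q))
  refine ⟨fun p => ⁅x i (f p), x j (g p)⁆, fun p q => ?_, key⟩
  -- With a common left factor, additivity reduces to additivity of the commutator in its second
  -- argument.
  obtain ⟨t, p, q, -, rfl, rfl⟩ := hm p q
  change ⁅x i (f (t * p + t * q)), x j (g (t * p + t * q))⁆ =
    ⁅x i (f (t * p)), x j (g (t * p))⁆ * ⁅x i (f (t * q)), x j (g (t * q))⁆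
  rw [← mul_add, ← key, ← key, ← key, hx.commutator_add_right h hN hm hν]

theorem _root_.RelSteinberg.map_neg_of_map_add {F : m → G} (hF : ∀ p q, F (p + q) = F p * F q)
    (p : m) : F (-p) = (F p)⁻¹ := by
  have h0 : F 0 = 1 := by
    have := hF 0 0
    rwa [add_zero, left_eq_mul] at this
  rw [eq_inv_iff_mul_eq_one, ← hF, neg_add_cancel, h0]

include h hN hm in
/-- The commutators `[x_i(p), x_j(q)]` with `i + j = ν` are values of a single homomorphism. -/
theorem exists_forall_commutator_eq (ν : ι) (hx : IsSteinbergOn r B N (· ≠ ν) x) :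
    ∃ y : m → G, (∀ p q, y (p + q) = y p * y q) ∧
      ∀ i j, r ν = r i + r j → ∀ p q, ⁅x i p, x j q⁆ = y (N i j • (p * q)) := by
  choose! F hF_add hF using fun (i j : ι) (hν : r ν = r i + r j) =>
    hx.exists_commutator_eq h hN hm hν
  have swap : ∀ i j, r ν = r i + r j → ∀ p, F j i (N j i • p) = F i j (N i j • p) := by
    intro i j hν p
    have hν' : r ν = r j + r i := by rw [hν, add_comm]
    have h1 : ∀ p, F j i p = (F i j p)⁻¹ := by
      intro p
      obtain ⟨a, b, rfl⟩ := hm.exists_mul p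
      rw [← hF _ _ hν', mul_comm, ← hF _ _ hν, commutatorElement_inv]
    rw [h1, hN.antisymm hν, neg_smul, map_neg_of_map_add (hF_add i j hν), inv_inv]
  -- Here i = i' + l and j' = l + j, so `commutator_shift` compares the two decompositions and the
  -- Jacobi identity matches the signs.
  have adj : ∀ i j i' j', r ν = r i + r j → r ν = r i' + r j' → B i i' = 1 →
      ∀ p, F i j (N i j • p) = F i' j' (N i' j' • p) := by
    intro i j i' j' hν hν' hii' p
    obtain ⟨l, hl⟩ := h.exists_sub hii'
    have ht : r j' = r l + r j := by
      have := hν.symm.trans hν'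
      rw [hl, add_assoc] at this
      exact (add_left_cancel this).symm
    have e1 := h.add_right hν i'
    have e2 := h.add_right hν' i'
    have e3 := h.symm i' i
    have e4 := h.eq_neg_one hν'
    have e5 := h.self i'
    have h0 : B i' j = 0 := by omega
    have hj := hN.jacobi hl ht hν h0
    obtain ⟨p, q, rfl⟩ := hm.exists_mul p
    obtain ⟨p, s, rfl⟩ := hm.exists_mul p
    have h1 := hx.commutator_shift h hN hm hν hl ht (N i j • N i' l • p) s q
    have h2 : N l j * N i j * N i' l = N i' j' := by
      rw [mul_assoc, mul_comm (N i j), hj, ← mul_assoc, hN.mul_self ht, one_mul]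
    rw [hF _ _ hν, hF _ _ hν'] at h1
    simp only [smul_mul_assoc, mul_smul_comm, smul_smul] at h1 ⊢
    rw [show N i' l * (N i j * N i' l) = N i j by linear_combination N i j * hN.mul_self hl,
      ← mul_assoc (N l j), h2, ← mul_assoc p] at h1
    exact h1
  obtain ⟨i₀, j₀, hν₀⟩ := h.exists_split ν
  refine ⟨fun p => F i₀ j₀ (N i₀ j₀ • p), fun p q => by
    simp only [smul_add, hF_add i₀ j₀ hν₀], fun i j hν p q => ?_⟩
  suffices hs : ∀ p, F i j (N i j • p) = F i₀ j₀ (N i₀ j₀ • p) by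
    change _ = F i₀ j₀ (N i₀ j₀ • _)
    rw [← hs, hF _ _ hν, hN.smul_smul_self hν]
  intro p
  have e1 := h.add_right hν i
  have e2 := h.add_right hν₀ i
  have e3 := h.eq_neg_one hν
  have e4 := h.self i
  have e5 := h.le_two i i₀
  have e6 := h.le_two i j₀
  -- Since `B i i₀` and `B i j₀` add up to `B i ν = 1`, any two decompositions of ν are equal or
  -- adjacent, possibly after a swap.
  obtain e | e | e | e : B i i₀ = 2 ∨ B i i₀ = 1 ∨ B i i₀ = 0 ∨ B i i₀ = -1 := by omega
  · obtain rfl := h.eq_of_eq_two e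
    have : j = j₀ := h.injective (add_left_cancel (hν.symm.trans hν₀))
    rw [this]
  · exact adj i j i₀ j₀ hν hν₀ e p
  · rw [adj i j j₀ i₀ hν (by rw [hν₀, add_comm]) (by omega) p, swap i₀ j₀ hν₀]
  · obtain rfl := h.eq_of_eq_two (show B i j₀ = 2 by omega)
    have : j = i₀ := h.injective (add_left_cancel (hν.symm.trans (hν₀.trans (add_comm _ _))))
    rw [this, ← swap i₀ i hν₀]

include h hN hm in
/-- **Elimination of a root.** A family satisfying all Steinberg relations that do not involve the
root `ν` extends to a family satisfying all Steinberg relations. -/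
theorem exists_extension (ν : ι) (hx : IsSteinbergOn r B N (· ≠ ν) x) :
    ∃ x' : ι → m → G, (∀ i, i ≠ ν → x' i = x i) ∧ IsSteinbergOn r B N (fun _ => True) x' := by
  classical
  obtain ⟨y, hy_add, hy⟩ := exists_forall_commutator_eq (hx := hx) h hN hm ν
  have hy' : ∀ {i j}, r ν = r i + r j → ∀ p q, y (p * q) = ⁅x i (N i j • p), x j q⁆ := by
    intro i j hν p q
    rw [hy i j hν, smul_mul_assoc, hN.smul_smul_self hν]
  -- For ν = i + j the products of l with i and j are opposite. Either both vanish and x_l commutes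
  -- with both factors, or `commute_of_cross` applies to (i, j) or (j, i).
  have hcomm0 : ∀ l, B l ν = 0 → ∀ p q, Commute (x l p) (y q) := by
    intro l hl p q
    obtain ⟨i, j, hν⟩ := h.exists_split ν
    obtain ⟨a, b, rfl⟩ := hm.exists_mul q
    rw [hy' hν]
    obtain ⟨hiν, hjν⟩ := h.ne_of_add hν
    have hlν : l ≠ ν := by rintro rfl; have := h.self l; omega
    have e1 := h.add_right hν l
    have e2 := h.le_two l i
    have e3 := h.le_two l j
    have e4 := h.add_right hν i
    have e5 := h.add_right hν j
    have e6 := h.eq_neg_one hν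
    have e7 := h.self i
    have e8 := h.self j
    have e9 := h.symm i j
    obtain e | e | e | e | e : B l i = 2 ∨ B l i = 1 ∨ B l i = 0 ∨ B l i = -1 ∨ B l j = 2 := by
      omega
    · obtain rfl := h.eq_of_eq_two e; omega
    · exact hx.commute_of_cross h hν e (by omega) _ _ _
    · exact commute_commutator (hx.commute hlν hiν (by omega) _ _)
        (hx.commute hlν hjν (by omega) _ _)
    · rw [← commutatorElement_inv]
      exact (hx.commute_of_cross h (by rw [hν, add_comm]) (by omega) e _ _ _).inv_right
    · obtain rfl := h.eq_of_eq_two e; omega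
  have hcomm1 : ∀ l, B l ν = 1 → ∀ p q, Commute (x l p) (y q) := by
    intro l hl p q
    obtain ⟨i, j, hν, hi, hj⟩ := h.exists_split_of_eq_one hl
    obtain ⟨a, b, rfl⟩ := hm.exists_mul q
    rw [hy' hν]
    obtain ⟨hiν, hjν⟩ := h.ne_of_add hν
    have hlν : l ≠ ν := by rintro rfl; have := h.self l; omega
    exact commute_commutator (hx.commute hlν hiν (by omega) _ _)
        (hx.commute hlν hjν (by omega) _ _)
  -- The decomposition ν = i + j is chosen so that l + i is a root while l is orthogonal to j;
  -- conjugation by x_l then changes only the x_i factor of the commutator.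
  have hcomm2 : ∀ l k, r k = r l + r ν → ∀ s p, ⁅x l s, y p⁆ = x k (N l ν • (s * p)) := by
    intro l k hk s p
    have el := h.eq_neg_one hk
    obtain ⟨l', hl'⟩ := h.exists_neg l
    have el' := h.neg_left hl'
    obtain ⟨i, j, hν, hi, hj⟩ := h.exists_split_of_eq_one (l := l') (k := ν) (by rw [el']; omega)
    rw [el'] at hi hj
    obtain ⟨a, b, rfl⟩ := hm.exists_mul p
    obtain ⟨hiν, hjν⟩ := h.ne_of_add hν
    obtain ⟨hlk, hνk⟩ := h.ne_of_add hk
    obtain ⟨t, ht⟩ := h.exists_add (i := l) (j := i) (by omega)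
    have hk' : r k = r t + r j := by rw [hk, ht, hν]; abel
    have e1 := h.add_left ht ν
    have e2 := h.add_right hν i
    have e3 := h.self i
    have e4 := h.eq_neg_one hν
    have e5 := h.self ν
    have e6 := h.add_left hk ν
    have hlν : l ≠ ν := by rintro rfl; omega
    have htν : t ≠ ν := by rintro rfl; omega
    have hjac := hN.jacobi ht hν hk' (by omega)
    have hw := hy' hν a b
    have hyab : Commute (x t (N l i • (s * (N i j • a)))) (y (a * b)) :=
      hcomm0 t (by omega) _ _
    have hkk : Commute (x k (N l ν • (s * (a * b)))) (y (a * b)) := hcomm1 k (by omega) _ _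
    have hz := hx.comm hlν hiν htν ht s (N i j • a)
    have hc := hx.commute hlν hjν (by omega) s b
    have hzc := hx.comm htν hjν hνk.symm hk' (N l i • (s * (N i j • a))) b
    have hsgn : N t j • (N l i • (s * N i j • a) * b) = N l ν • (s * (a * b)) := by
      have : N t j * N l i * N i j = N l ν := by
        rw [mul_comm (N t j), hjac, mul_right_comm, hN.mul_self hν, one_mul]
      simp only [smul_mul_assoc, mul_smul_comm, smul_smul]
      rw [← mul_assoc (N t j), this, mul_assoc]
    rw [hsgn] at hzc
    rw [hw] at hyab hkk ⊢
    set β := x i (N i j • a)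
    set γ := x j b
    set δ := x l s
    set z := x t (N l i • (s * N i j • a))
    have h1 : δ * ⁅β, γ⁆ * δ⁻¹ = ⁅z * β, γ⁆ := by
      have e1 : z * β = δ * β * δ⁻¹ := by rw [← hz, commutatorElement_def]; group
      have e2 : γ = δ * γ * δ⁻¹ := by rw [hc.eq]; group
      rw [e1]
      nth_rw 2 [e2]
      simp only [commutatorElement_def]
      group
    rw [commutator_mul_left_of_commute hyab, hzc, ← hkk.eq] at h1
    rw [commutatorElement_def δ, h1]
    group
  have hνν : ∀ p q, Commute (y p) (y q) := fun p q => by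
    rw [Commute, SemiconjBy, ← hy_add, ← hy_add, add_comm]
  refine ⟨fun i => if i = ν then y else x i, fun i hi => if_neg hi, ⟨?_, ?_, ?_⟩⟩
  · intro i _ p q
    by_cases hi : i = ν
    · simp only [hi, if_true]; exact hy_add p q
    · simp only [hi, if_false]; exact hx.map_add hi p q
  · intro i j k _ _ _ hk p q
    obtain ⟨hik, hjk⟩ := h.ne_of_add hk
    by_cases hi : i = ν
    · subst hi
      have hji : j ≠ i := by rintro rfl; have := h.eq_neg_one hk; have := h.self j; omega
      simp only [if_true, hji, if_false, hik.symm]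
      rw [← commutatorElement_inv, hcomm2 j k (by rw [hk, add_comm]), ← map_neg_of_map_add
        (hx.map_add hik.symm), hN.antisymm hk, neg_smul, neg_neg, mul_comm]
    by_cases hj : j = ν
    · subst hj
      simp only [if_true, hi, if_false, hjk.symm]
      exact hcomm2 i k hk p q
    by_cases hkν : k = ν
    · subst hkν
      simp only [if_true, hi, hj, if_false]
      exact hy i j hk p q
    simp only [hi, hj, hkν, if_false]
    exact hx.comm hi hj hkν hk p q
  · intro i j _ _ hij p q
    have key : ∀ l, l ≠ ν → 0 ≤ B l ν → ∀ p q, Commute (x l p) (y q) := by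
      intro l hl h0
      have := h.le_two l ν
      obtain e | e | e : B l ν = 0 ∨ B l ν = 1 ∨ B l ν = 2 := by omega
      exacts [hcomm0 l e, hcomm1 l e, absurd (h.eq_of_eq_two e) hl]
    by_cases hi : i = ν <;> by_cases hj : j = ν
    · simp only [hi, hj, if_true]; exact hνν p q
    · simp only [hi, if_true, hj, if_false]
      exact (key j hj (by rw [h.symm, ← hi]; exact hij) q p).symm
    · simp only [hj, if_true, hi, if_false]
      exact key i hi (by rw [← hj]; exact hij) p q
    · simp only [hi, hj, if_false]
      exact hx.commute hi hj hij p q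

end IsSteinbergOn

end Extension

end RelSteinberg

/-! ### The Steinberg group of a non-unital ring and the conjugation action on it. -/

namespace RelSteinberg

set_option linter.unusedSectionVars false

open scoped commutatorElement

section NonUnital

variable {ι V m G : Type*} [AddCommGroup V] [NonUnitalCommRing m] [Group G]

/-- The defining relators of the Steinberg group of a non-unital ring. -/
inductive NonUnitalRelator (r : ι → V) (B N : ι → ι → ℤ) (m : Type*) [NonUnitalCommRing m] :
    FreeGroup (ι × m) → Prop
  | add (i : ι) (p q : m) : NonUnitalRelator r B N m
      (FreeGroup.of (i, p) * FreeGroup.of (i, q) * (FreeGroup.of (i, p + q))⁻¹)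
  | comm (i j k : ι) (p q : m) (h : r k = r i + r j) : NonUnitalRelator r B N m
      (⁅FreeGroup.of (i, p), FreeGroup.of (j, q)⁆ * (FreeGroup.of (k, N i j • (p * q)))⁻¹)
  | commute (i j : ι) (p q : m) (h : 0 ≤ B i j) : NonUnitalRelator r B N m
      ⁅FreeGroup.of (i, p), FreeGroup.of (j, q)⁆

/-- The Steinberg group of a non-unital ring. -/
abbrev NonUnitalSt (r : ι → V) (B N : ι → ι → ℤ) (m : Type*) [NonUnitalCommRing m] : Type _ :=
  PresentedGroup {w : FreeGroup (ι × m) | NonUnitalRelator r B N m w}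

namespace NonUnitalSt

variable {r : ι → V} {B N : ι → ι → ℤ}

variable (r B N) in
/-- The generators of the Steinberg group of a non-unital ring. -/
def x (i : ι) (p : m) : NonUnitalSt r B N m := PresentedGroup.of (i, p)

theorem isSteinbergOn_x :
    IsSteinbergOn r B N (fun _ => True) (x r B N : ι → m → NonUnitalSt r B N m) where
  map_add {i} _ p q := (PresentedGroup.mk_eq_mk_of_mul_inv_mem (NonUnitalRelator.add i p q)).symm
  comm {i j k} _ _ _ hk p q :=
    PresentedGroup.mk_eq_mk_of_mul_inv_mem (NonUnitalRelator.comm i j k p q hk)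
  commute {i j} _ _ hij p q := commutatorElement_eq_one_iff_commute.1
    (PresentedGroup.one_of_mem (NonUnitalRelator.commute i j p q hij))

/-- The homomorphism defined by a family satisfying the Steinberg relations. -/
def lift {x' : ι → m → G} (hx : IsSteinbergOn r B N (fun _ => True) x') :
    NonUnitalSt r B N m →* G :=
  PresentedGroup.toGroup (f := fun p : ι × m => x' p.1 p.2) (by
    rintro w (⟨i, p, q⟩ | ⟨i, j, k, p, q, hk⟩ | ⟨i, j, p, q, hij⟩)
    · simp [hx.map_add]
    · simp [map_commutatorElement, hx.comm trivial trivial trivial hk]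
    · simp only [map_commutatorElement, FreeGroup.lift_apply_of]
      exact commutatorElement_eq_one_iff_commute.2 (hx.commute trivial trivial hij p q))

@[simp]
theorem lift_x {x' : ι → m → G} (hx : IsSteinbergOn r B N (fun _ => True) x') (i : ι) (p : m) :
    lift hx (x r B N i p) = x' i p :=
  PresentedGroup.toGroup.of _

variable (h : SimplyLacedForm r B) (hN : StructureConstants r B N) (hm : HasRegularFactors m)

include hN hm in
theorem exists_x_eq_commutator {i j k : ι} (hk : r k = r i + r j) (p : m) :
    ∃ a b : m, x r B N k p = ⁅x r B N i a, x r B N j b⁆ := by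
  obtain ⟨a, b, rfl⟩ := hm.exists_mul p
  refine ⟨N i j • a, b, ?_⟩
  rw [isSteinbergOn_x.comm trivial trivial trivial hk, smul_mul_assoc, hN.smul_smul_self hk]

-- Every root element of a sum i + j is a commutator of root elements of i and j.
include hN hm in
theorem hom_ext {f g : NonUnitalSt r B N m →* G} (P : ι → Prop)
    (hP : ∀ k, ¬P k → ∃ i j, r k = r i + r j ∧ P i ∧ P j)
    (hfg : ∀ i, P i → ∀ p, f (x r B N i p) = g (x r B N i p)) : f = g := by
  refine PresentedGroup.ext fun ⟨k, p⟩ => ?_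
  change f (x r B N k p) = g (x r B N k p)
  by_cases hk : P k
  · exact hfg k hk p
  · obtain ⟨i, j, hij, hi, hj⟩ := hP k hk
    obtain ⟨a, b, hab⟩ := exists_x_eq_commutator hN hm hij p
    rw [hab, map_commutatorElement, map_commutatorElement, hfg i hi, hfg j hj]

end NonUnitalSt

section Conjugation

variable {r : ι → V} {B N : ι → ι → ℤ} {C : Type*} [CommRing C] [Module C m]
  [IsScalarTower C m m] [SMulCommClass C m m]
  (h : SimplyLacedForm r B) (hN : StructureConstants r B N) (hm : HasRegularFactors m)

theorem _root_.RelSteinberg.smul_smul_mul_left (c : C) (a b : ℤ) (p q : m) :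
    a • ((b • c • p) * q) = (a * b) • c • (p * q) := by
  rw [smul_mul_assoc, smul_mul_assoc, smul_smul]

theorem _root_.RelSteinberg.smul_smul_mul_right (c : C) (a b : ℤ) (p q : m) :
    a • (p * (b • c • q)) = (a * b) • c • (p * q) := by
  rw [mul_smul_comm, mul_smul_comm, smul_smul]

theorem _root_.RelSteinberg.smul_smul_smul_smul (c d : C) (a b : ℤ) (p : m) :
    a • c • b • d • p = (a * b) • (c * d) • p := by
  rw [smul_comm c b, smul_smul, mul_smul c d]

include h hN in
/-- Conjugating the elements `x i p` by a formal root element `x α c` preserves the Steinberg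
relations that do not involve the root opposite to `α`. -/
theorem isSteinbergOn_conj {x y : ι → m → G} (hx : IsSteinbergOn r B N (fun _ => True) x)
    {α ν : ι} (hν : r ν = -r α) (c : C)
    (hy : ∀ i k, r k = r α + r i → ∀ p, y i p = x k (N α i • c • p) * x i p)
    (hy' : ∀ i, 0 ≤ B α i → ∀ p, y i p = x i p) : IsSteinbergOn r B N (· ≠ ν) y := by
  have hcases : ∀ i, i ≠ ν → B α i = -1 ∨ 0 ≤ B α i := by
    intro i hi
    have h1 := h.neg_two_le α i
    have h2 : B α i ≠ -2 := fun h2 => hi <| h.injective <| by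
      rw [hν, ← neg_eq_iff_add_eq_zero.2 (h.eq_neg_two_iff.1 h2)]
    omega
  have hxc : ∀ {i j}, 0 ≤ B i j → ∀ p q, Commute (x i p) (x j q) := hx.commute trivial trivial
  have hxk : ∀ {i j k}, r k = r i + r j → ∀ p q, ⁅x i p, x j q⁆ = x k (N i j • (p * q)) :=
    hx.comm trivial trivial trivial
  have hxa : ∀ i p q, x i (p + q) = x i p * x i q := fun i => hx.map_add trivial
  have hadd : ∀ i, i ≠ ν → ∀ p q, y i (p + q) = y i p * y i q := by
    intro i hi p q
    rcases hcases i hi with hi1 | hi0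
    · obtain ⟨i', hi'⟩ := h.exists_add hi1
      have e1 := h.add_left hi' i
      have e2 := h.self i
      rw [hy i i' hi', hy i i' hi', hy i i' hi', smul_add, smul_add, hxa, hxa, mul_assoc, mul_assoc,
        ← mul_assoc (x i p), (hxc (i := i) (j := i') (by rw [h.symm]; omega) _ _).eq, mul_assoc]
    · rw [hy' i hi0, hy' i hi0, hy' i hi0, hxa]
  have hcomm : ∀ i j k, B α i = -1 → 0 ≤ B α j → r k = r i + r j →
      ∀ p q, ⁅y i p, y j q⁆ = y k (N i j • (p * q)) := by
    intro i j k hi hj hk p q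
    obtain ⟨i', hi'⟩ := h.exists_add hi
    have e1 := h.add_left hi' k
    have e2 := h.add_left hi' j
    have e3 := h.add_right hk i
    have e4 := h.self i
    have e5 := h.eq_neg_one hk
    have e6 := h.add_right hk α
    rw [hy i i' hi', hy' j hj]
    have h1 : Commute (x i' (N α i • c • p)) ⁅x i p, x j q⁆ := by
      rw [hxk hk]
      exact hxc (by omega) _ _
    rw [commutator_mul_left_of_commute h1, hxk hk]
    obtain hj0 | hj1 : B α j = 0 ∨ 1 ≤ B α j := by omega
    · obtain ⟨k', hk'⟩ := h.exists_add (i := α) (j := k) (by omega)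
      have hk'' : r k' = r i' + r j := by rw [hk', hk, hi']; abel
      have e7 := h.add_left hk' k
      have e8 := h.self k
      rw [hy k k' hk', hxk hk'', (hxc (i := k) (j := k') (by rw [h.symm]; omega) _ _).eq,
        smul_smul_mul_left, mul_comm (N i' j), hN.jacobi hi' hk hk'' hj0, smul_comm c (N i j),
        smul_smul, mul_comm (N i j)]
    · rw [hy' k (by omega), commutatorElement_eq_one_iff_commute.2 (hxc (by omega) _ _), mul_one]
  have hcommute : ∀ i j, B α i = -1 → 0 ≤ B α j → 0 ≤ B i j →
      ∀ p q, Commute (y i p) (y j q) := by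
    intro i j hi hj hij p q
    obtain ⟨i', hi'⟩ := h.exists_add hi
    have e1 := h.add_left hi' j
    rw [hy i i' hi', hy' j hj]
    exact (hxc (by omega) _ _).mul_left (hxc hij _ _)
  refine ⟨fun {i} hi => hadd i hi, fun {i j k} hi hj hk hkij p q => ?_, fun {i j} hi hj hij p q => ?_⟩
  · have e1 := h.add_right hkij α
    rcases hcases i hi with hi1 | hi0 <;> rcases hcases j hj with hj1 | hj0
    -- Here `B α k = -2`, that is k = -α, which is excluded.
    · rcases hcases k hk with hk1 | hk1 <;> omega
    · exact hcomm i j k hi1 hj0 hkij p q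
    · rw [← commutatorElement_inv, hcomm j i k hj1 hi0 (by rw [hkij, add_comm]),
        ← map_neg_of_map_add (hadd k hk), hN.antisymm hkij, neg_smul, neg_neg, mul_comm]
    · rw [hy' i hi0, hy' j hj0, hy' k (by omega), hxk hkij]
  · rcases hcases i hi with hi1 | hi0 <;> rcases hcases j hj with hj1 | hj0
    · obtain ⟨i', hi'⟩ := h.exists_add hi1
      obtain ⟨j', hj'⟩ := h.exists_add hj1
      have e1 := h.add_left hi' j
      have e2 := h.add_left hi' j'
      have e3 := h.add_right hj' i
      have e4 := h.add_right hj' α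
      have e5 := h.self α
      have e6 := h.symm i α
      rw [hy i i' hi', hy j j' hj']
      -- For orthogonal i and j the cross terms [x_i, x_(α+j)] and [x_(α+i), x_j] both lie in the
      -- root subgroup of α + i + j, and they cancel by the Jacobi identity. Otherwise all four
      -- factors commute.
      obtain hij0 | hij1 : B i j = 0 ∨ 1 ≤ B i j := by omega
      · obtain ⟨n, hn⟩ := h.exists_add (i := i') (j := j) (by omega)
        have hn' : r n = r i + r j' := by rw [hn, hi', hj']; abel
        have hi'' : r i' = r i + r α := by rw [hi', add_comm]
        have hjac := hN.jacobi hi'' hj' hn hij0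
        rw [hN.antisymm hi'] at hjac
        have f1 := h.add_left hn i'
        have f2 := h.add_left hn j'
        have f3 := h.self i'
        have f4 := h.self j
        have f5 := h.add_left hj' j
        have f6 := h.symm j i'
        have f7 := h.symm j j'
        have s1 : ∀ p q u, ⁅x i p, x j' q * x j u⁆ = x n (N i j' • (p * q)) := by
          intro p q u
          have : ⁅x i p, x j u⁆ = 1 := commutatorElement_eq_one_iff_commute.2 (hxc hij _ _)
          rw [commutator_mul_right_of_commute (by rw [this]; exact Commute.one_right _), this,
            mul_one, hxk hn']
        have s2 : ∀ p q u, ⁅x i' p, x j' q * x j u⁆ = x n (N i' j • (p * u)) := by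
          intro p q u
          have : ⁅x i' p, x j' q⁆ = 1 :=
            commutatorElement_eq_one_iff_commute.2 (hxc (by omega) _ _)
          rw [commutator_mul_right_of_commute, this, one_mul, hxk hn]
          rw [hxk hn]
          exact (hxc (by omega) _ _).symm
        rw [← commutatorElement_eq_one_iff_commute, commutator_mul_left_of_commute, s1 _ _ _,
          s2 _ _ _, ← hxa, smul_smul_mul_left, smul_smul_mul_right, ← add_smul,
          show N i j' * N α j + N i' j * N α i = 0 by linear_combination -hjac, zero_smul,
          ← left_eq_mul (a := x n 0), ← hxa, add_zero]
        rw [s1 _ _ _]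
        exact (hxc (by omega) _ _).symm
      · have := h.symm j α
        exact ((hxc (by omega) _ _).mul_right (hxc (by omega) _ _)).mul_left
          ((hxc (by omega) _ _).mul_right (hxc (by omega) _ _))
    · exact hcommute i j hi1 hj0 hij p q
    · exact (hcommute j i hj1 hi0 (by rw [h.symm]; exact hij) q p).symm
    · rw [hy' i hi0, hy' j hj0]
      exact hxc hij p q

-- The formulas define the images of all root elements except those of -α; `exists_extension`
-- supplies the missing ones.
include h hN hm in
theorem NonUnitalSt.exists_conj (α : ι) (c : C) :
    ∃ φ : NonUnitalSt r B N m →* NonUnitalSt r B N m,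
      (∀ i k, r k = r α + r i → ∀ p, φ (x r B N i p) = x r B N k (N α i • c • p) * x r B N i p) ∧
      ∀ i, 0 ≤ B α i → ∀ p, φ (x r B N i p) = x r B N i p := by
  classical
  obtain ⟨ν, hν⟩ := h.exists_neg α
  let y : ι → m → NonUnitalSt r B N m := fun i p =>
    if hi : ∃ k, r k = r α + r i then x r B N hi.choose (N α i • c • p) * x r B N i p
    else x r B N i p
  have hy : ∀ i k, r k = r α + r i → ∀ p, y i p = x r B N k (N α i • c • p) * x r B N i p := by
    intro i k hk p
    have hi : ∃ k, r k = r α + r i := ⟨k, hk⟩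
    have : hi.choose = k := h.injective (hi.choose_spec.trans hk.symm)
    simp only [y, dif_pos hi, this]
  have hy' : ∀ i, 0 ≤ B α i → ∀ p, y i p = x r B N i p := by
    intro i hi p
    refine dif_neg ?_
    rintro ⟨k, hk⟩
    have := h.eq_neg_one hk
    omega
  obtain ⟨x', hx', hst⟩ := IsSteinbergOn.exists_extension h hN hm ν
    (isSteinbergOn_conj h hN isSteinbergOn_x hν c hy hy')
  have hne : ∀ i, -1 ≤ B α i → i ≠ ν := by
    rintro i hi rfl
    have : B α i = -2 := h.eq_neg_two_iff.2 (by rw [hν]; abel)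
    omega
  refine ⟨lift hst, fun i k hk p => ?_, fun i hi p => ?_⟩
  · rw [lift_x, hx' i (hne i (h.eq_neg_one hk).ge), hy i k hk]
  · rw [lift_x, hx' i (hne i (by omega)), hy' i hi]

/-- The endomorphism of the Steinberg group of a non-unital `C`-algebra which is to be thought of
as the conjugation by the root element `x α c`. -/
noncomputable def NonUnitalSt.conj (α : ι) (c : C) :
    NonUnitalSt r B N m →* NonUnitalSt r B N m :=
  (NonUnitalSt.exists_conj h hN hm α c).choose

theorem NonUnitalSt.conj_x {α i k : ι} (hk : r k = r α + r i) (c : C) (p : m) :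
    conj h hN hm α c (x r B N i p) = x r B N k (N α i • c • p) * x r B N i p :=
  (NonUnitalSt.exists_conj h hN hm α c).choose_spec.1 i k hk p

theorem NonUnitalSt.conj_x_of_nonneg {α i : ι} (hi : 0 ≤ B α i) (c : C) (p : m) :
    conj h hN hm α c (x r B N i p) = x r B N i p :=
  (NonUnitalSt.exists_conj h hN hm α c).choose_spec.2 i hi p

-- A summand equal to -β is removed by a root l as in `exists_cross`: k = (i - l) + (j + l).
include h in
theorem _root_.RelSteinberg.SimplyLacedForm.exists_split_avoiding (k β : ι) :
    ∃ i j, r k = r i + r j ∧ B β i ≠ -2 ∧ B β j ≠ -2 := by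
  have key : ∀ i j, r k = r i + r j → B β i = -2 →
      ∃ i j, r k = r i + r j ∧ B β i ≠ -2 ∧ B β j ≠ -2 := by
    intro i j hk hi
    obtain ⟨l, hl1, hl2⟩ := h.exists_cross hk
    obtain ⟨i', hi'⟩ := h.exists_sub (i := i) (j := l) (by rw [h.symm, hl1])
    obtain ⟨j', hj'⟩ := h.exists_add hl2
    have hβ : r i = -r β := (neg_eq_of_add_eq_zero_right (h.eq_neg_two_iff.1 hi)).symm
    have e1 := h.neg_left hβ i'
    have e2 := h.neg_left hβ j'
    have e3 := h.add_right hi' i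
    have e4 := h.add_right hj' i
    have e5 := h.self i
    have e6 := h.symm l i
    have e7 := h.eq_neg_one hk
    exact ⟨i', j', by rw [hk, hi', hj']; abel, by omega, by omega⟩
  obtain ⟨i, j, hk⟩ := h.exists_split k
  by_cases hi : B β i = -2
  · exact key i j hk hi
  by_cases hj : B β j = -2
  · exact key j i (by rw [hk, add_comm]) hj
  exact ⟨i, j, hk, hi, hj⟩

include h in
theorem _root_.RelSteinberg.SimplyLacedForm.ne_neg_two_of_add {i j k α : ι}
    (hk : r k = r i + r j) (hα : B α k = -2) : B α i ≠ -2 ∧ B α j ≠ -2 := by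
  have e1 := h.add_right hk α
  constructor <;> intro h1
  · have e2 : r i = -r α := (neg_eq_of_add_eq_zero_right (h.eq_neg_two_iff.1 h1)).symm
    have e3 : r k = -r α := (neg_eq_of_add_eq_zero_right (h.eq_neg_two_iff.1 hα)).symm
    exact (h.ne_of_add hk).1 (h.injective (e2.trans e3.symm))
  · have e2 : r j = -r α := (neg_eq_of_add_eq_zero_right (h.eq_neg_two_iff.1 h1)).symm
    have e3 : r k = -r α := (neg_eq_of_add_eq_zero_right (h.eq_neg_two_iff.1 hα)).symm
    exact (h.ne_of_add hk).2 (h.injective (e2.trans e3.symm))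

namespace NonUnitalSt

/-- `conj` is explicit only away from the opposite root, so identities between composites of `conj
α` and `conj β` have to be tested away from -α and -β. -/
theorem hom_ext_of_ne_neg {f g : NonUnitalSt r B N m →* G} (α β : ι)
    (h : SimplyLacedForm r B) (hN : StructureConstants r B N) (hm : HasRegularFactors m)
    (hfg : ∀ i, B α i ≠ -2 → B β i ≠ -2 → ∀ p, f (x r B N i p) = g (x r B N i p)) : f = g := by
  refine hom_ext hN hm (fun i => B α i ≠ -2 ∧ B β i ≠ -2) (fun k hk => ?_)
    fun i hi => hfg i hi.1 hi.2
  by_cases hα : B α k = -2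
  · obtain ⟨i, j, hij, hi, hj⟩ := h.exists_split_avoiding k β
    have := h.ne_neg_two_of_add hij hα
    exact ⟨i, j, hij, ⟨this.1, hi⟩, ⟨this.2, hj⟩⟩
  · have hβ : B β k = -2 := by tauto
    obtain ⟨i, j, hij, hi, hj⟩ := h.exists_split_avoiding k α
    have := h.ne_neg_two_of_add hij hβ
    exact ⟨i, j, hij, ⟨hi, this.1⟩, ⟨hj, this.2⟩⟩

-- The bounds express that i and j differ from ±u, ±v and ±k. The decomposition is (u - l) + (v + l)
-- with l as in `exists_cross`.
include h in
theorem exists_split_of_triple {u v k : ι} (hk : r k = r u + r v) :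
    ∃ i j, r k = r i + r j ∧ ∀ w, w = i ∨ w = j →
      (-1 ≤ B u w ∧ B u w ≤ 1) ∧ (-1 ≤ B v w ∧ B v w ≤ 1) ∧ -1 ≤ B k w ∧ B k w ≤ 1 := by
  obtain ⟨l, hl1, hl2⟩ := h.exists_cross hk
  obtain ⟨i, hi⟩ := h.exists_sub (i := u) (j := l) (by rw [h.symm, hl1])
  obtain ⟨j, hj⟩ := h.exists_add hl2
  have e0 := h.eq_neg_one hk
  have e1 := h.add_left hi u
  have e2 := h.add_left hi v
  have e3 := h.add_left hj u
  have e4 := h.add_left hj v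
  have e5 := h.self u
  have e6 := h.self v
  have e7 := h.symm u v
  have e8 := h.add_left hk i
  have e9 := h.add_left hk j
  have f1 := h.symm u i
  have f2 := h.symm u j
  have f3 := h.symm v i
  have f4 := h.symm v j
  refine ⟨i, j, by rw [hk, hi, hj]; abel, ?_⟩
  rintro w (rfl | rfl) <;> omega

/-- Each of -α, -β, -κ is a sum of two roots from {±α, ±β, ±κ}, so `exists_split_of_triple` rewrites
it as a sum of two roots avoiding all three. -/
theorem hom_ext_of_ne_neg_add {f g : NonUnitalSt r B N m →* G} {α β κ : ι}
    (hκ : r κ = r α + r β)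
    (h : SimplyLacedForm r B) (hN : StructureConstants r B N) (hm : HasRegularFactors m)
    (hfg : ∀ i, B α i ≠ -2 → B β i ≠ -2 → B κ i ≠ -2 →
      ∀ p, f (x r B N i p) = g (x r B N i p)) : f = g := by
  refine hom_ext hN hm (fun i => B α i ≠ -2 ∧ B β i ≠ -2 ∧ B κ i ≠ -2) (fun k hk => ?_)
    fun i hi => hfg i hi.1 hi.2.1 hi.2.2
  obtain ⟨α', hα'⟩ := h.exists_neg α
  obtain ⟨β', hβ'⟩ := h.exists_neg β
  obtain ⟨κ', hκ'⟩ := h.exists_neg κ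
  have eq : ∀ {γ γ'}, r γ' = -r γ → B γ k = -2 → k = γ' := fun h1 h2 => h.injective <| by
    rw [h1]; exact (neg_eq_of_add_eq_zero_right (h.eq_neg_two_iff.1 h2)).symm
  have nα := h.neg_left hα'
  have nβ := h.neg_left hβ'
  have nκ := h.neg_left hκ'
  by_cases hα : B α k = -2
  · obtain rfl := eq hα' hα
    obtain ⟨i, j, hij, hw⟩ := exists_split_of_triple h (k := k) (u := κ') (v := β)
      (by rw [hα', hκ', hκ]; abel)
    have hi := hw i (Or.inl rfl)
    have hj := hw j (Or.inr rfl)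
    rw [nα, nκ] at hi hj
    exact ⟨i, j, hij, by omega, by omega⟩
  by_cases hβ : B β k = -2
  · obtain rfl := eq hβ' hβ
    obtain ⟨i, j, hij, hw⟩ := exists_split_of_triple h (k := k) (u := κ') (v := α)
      (by rw [hβ', hκ', hκ]; abel)
    have hi := hw i (Or.inl rfl)
    have hj := hw j (Or.inr rfl)
    rw [nβ, nκ] at hi hj
    exact ⟨i, j, hij, by omega, by omega⟩
  · obtain rfl := eq hκ' (by tauto : B κ k = -2)
    obtain ⟨i, j, hij, hw⟩ := exists_split_of_triple h (k := k) (u := α') (v := β')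
      (by rw [hα', hκ', hβ', hκ]; abel)
    have hi := hw i (Or.inl rfl)
    have hj := hw j (Or.inr rfl)
    rw [nα, nκ, nβ] at hi hj
    exact ⟨i, j, hij, by omega, by omega⟩

theorem conj_comp_conj (α : ι) (c d : C) :
    (conj h hN hm α c).comp (conj h hN hm α d) = conj h hN hm α (c + d) := by
  refine hom_ext_of_ne_neg α α h hN hm fun i hi _ p => ?_
  have e1 := h.neg_two_le α i
  rw [MonoidHom.comp_apply]
  obtain hi1 | hi0 : B α i = -1 ∨ 0 ≤ B α i := by omega
  · obtain ⟨k, hk⟩ := h.exists_add hi1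
    have e2 := h.add_right hk α
    have e3 := h.self α
    rw [conj_x h hN hm hk, conj_x h hN hm hk, map_mul, conj_x h hN hm hk,
      conj_x_of_nonneg h hN hm (by omega), ← mul_assoc, ← isSteinbergOn_x.map_add trivial,
      ← smul_add, ← add_smul, add_comm d c]
  · simp only [conj_x_of_nonneg h hN hm hi0]

theorem conj_zero (α : ι) : conj h hN hm α (0 : C) = MonoidHom.id (NonUnitalSt r B N m) := by
  refine hom_ext_of_ne_neg α α h hN hm fun i hi _ p => ?_
  have e1 := h.neg_two_le α i
  obtain hi1 | hi0 : B α i = -1 ∨ 0 ≤ B α i := by omega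
  · obtain ⟨k, hk⟩ := h.exists_add hi1
    rw [conj_x h hN hm hk, zero_smul, smul_zero, MonoidHom.id_apply, mul_eq_right,
      ← left_eq_mul (a := x r B N k 0), ← isSteinbergOn_x.map_add trivial, add_zero]
  · rw [conj_x_of_nonneg h hN hm hi0, MonoidHom.id_apply]

/-- `conj` as an automorphism. -/
noncomputable def conjAut (α : ι) (c : C) : MulAut (NonUnitalSt r B N m) :=
  MonoidHom.toMulEquiv (conj h hN hm α c) (conj h hN hm α (-c))
    (by rw [conj_comp_conj, neg_add_cancel, conj_zero])
    (by rw [conj_comp_conj, add_neg_cancel, conj_zero])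

theorem conj_comp_conj_of_nonneg {α β : ι} (hαβ : 0 ≤ B α β) (c d : C) :
    (conj h hN hm α c).comp (conj h hN hm β d) = (conj h hN hm β d).comp (conj h hN hm α c) := by
  have key : ∀ α β, 0 ≤ B α β → ∀ c d : C, ∀ i, B α i = -1 → 0 ≤ B β i → ∀ p : m,
      conj h hN hm α c (conj h hN hm β d (x r B N i p)) =
        conj h hN hm β d (conj h hN hm α c (x r B N i p)) := by
    intro α β hαβ c d i hi hi' p
    obtain ⟨k, hk⟩ := h.exists_add hi
    have e1 := h.add_right hk β
    have e2 := h.symm α β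
    rw [conj_x_of_nonneg h hN hm hi', conj_x h hN hm hk, map_mul,
      conj_x_of_nonneg h hN hm hi', conj_x_of_nonneg h hN hm (by omega)]
  refine hom_ext_of_ne_neg α β h hN hm fun i hiα hiβ p => ?_
  rw [MonoidHom.comp_apply, MonoidHom.comp_apply]
  have e1 := h.neg_two_le α i
  have e2 := h.neg_two_le β i
  obtain hα1 | hα0 : B α i = -1 ∨ 0 ≤ B α i := by omega
  · obtain hβ1 | hβ0 : B β i = -1 ∨ 0 ≤ B β i := by omega
    · obtain ⟨α', hα'⟩ := h.exists_add hα1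
      obtain ⟨β', hβ'⟩ := h.exists_add hβ1
      have e3 := h.add_right hβ' α
      have e4 := h.add_right hα' β
      have e5 := h.add_right hβ' α'
      have e6 := h.symm α β
      have e7 := h.add_left hα' i
      have e8 := h.self i
      have e9 := h.symm α' β
      have hc : ∀ p q : m, Commute (x r B N α' p) (x r B N β' q) :=
        isSteinbergOn_x.commute trivial trivial (by omega)
      rw [conj_x h hN hm hα', conj_x h hN hm hβ', map_mul, map_mul, conj_x h hN hm hα',
        conj_x h hN hm hβ']
      -- For orthogonal α and β the root n = α + β + i is reached through α + i and through β + i;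
      -- the two coefficients agree by the Jacobi identity.
      obtain h0 | h1 : B α β = 0 ∨ 1 ≤ B α β := by omega
      · obtain ⟨n, hn⟩ := h.exists_add (i := α) (j := β') (by omega)
        have hn' : r n = r β + r α' := by rw [hn, hα', hβ']; abel
        have hjac := hN.jacobi (a := α) (b := i) (c := β) (n := n) hα' (bc := β')
          (by rw [hβ', add_comm]) (by rw [hn', add_comm]) h0
        rw [hN.antisymm hβ', hN.antisymm hn'] at hjac
        rw [conj_x h hN hm hn, conj_x h hN hm hn', mul_assoc, mul_assoc, ← mul_assoc (x r B N β' _),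
          ← mul_assoc (x r B N α' _), (hc _ _).eq]
        congr 2
        rw [smul_smul_smul_smul, smul_smul_smul_smul, mul_comm d c,
          show N α β' * N β i = N β α' * N α i by linear_combination hjac]
      · rw [conj_x_of_nonneg h hN hm (by omega), conj_x_of_nonneg h hN hm (by omega), ← mul_assoc,
          ← mul_assoc, (hc _ _).eq]
    · exact key α β hαβ c d i hα1 hβ0 p
  · obtain hβ1 | hβ0 : B β i = -1 ∨ 0 ≤ B β i := by omega
    · exact (key β α (by rw [h.symm]; exact hαβ) d c i hβ1 hα0 p).symm
    · simp only [conj_x_of_nonneg h hN hm hα0, conj_x_of_nonneg h hN hm hβ0]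

theorem conj_comp_conj_of_add {α β κ : ι} (hκ : r κ = r α + r β) (c d : C) :
    (conj h hN hm α c).comp (conj h hN hm β d) =
      ((conj h hN hm κ (N α β • (c * d))).comp (conj h hN hm β d)).comp
        (conj h hN hm α c) := by
  refine hom_ext_of_ne_neg_add hκ h hN hm fun i hiα hiβ hiκ p => ?_
  simp only [MonoidHom.comp_apply]
  have e1 := h.neg_two_le α i
  have e2 := h.neg_two_le β i
  have e3 := h.add_left hκ i
  have e4 := h.eq_neg_one hκ
  have e5 := h.add_left hκ α
  have e6 := h.add_left hκ β
  have e7 := h.symm α β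
  have e8 := h.self α
  have e9 := h.self β
  obtain hα1 | hα0 : B α i = -1 ∨ 0 ≤ B α i := by omega
  -- As `B κ i = B α i + B β i` is not -2, at most one of α and β moves x_i.
  · have hβ0 : 0 ≤ B β i := by omega
    obtain ⟨α', hα'⟩ := h.exists_add hα1
    have f1 := h.add_right hα' β
    have f2 := h.add_right hα' κ
    rw [conj_x_of_nonneg h hN hm hβ0, conj_x h hN hm hα', map_mul,
      conj_x_of_nonneg h hN hm hβ0, map_mul]
    obtain h0 | h1 : B β i = 0 ∨ 1 ≤ B β i := by omega
    · obtain ⟨n, hn⟩ := h.exists_add (i := β) (j := α') (by omega)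
      have hn' : r n = r κ + r i := by rw [hn, hα', hκ]; abel
      have hjac := hN.jacobi (a := β) (b := α) (c := i) (n := n) (ab := κ) (bc := α')
        (by rw [hκ, add_comm]) hα' hn' h0
      rw [hN.antisymm hκ] at hjac
      have f3 := h.add_right hn κ
      have f4 := h.add_left hα' n
      have f5 := h.add_right hn α
      have f6 := h.add_right hn i
      have f7 := h.symm i β
      have f8 := h.add_left hα' i
      have f9 := h.symm i α'
      have f10 := h.self i
      have f11 := h.add_right hα' α
      rw [conj_x h hN hm hn, map_mul, conj_x_of_nonneg h hN hm (i := n) (by omega),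
        conj_x_of_nonneg h hN hm (i := α') (by omega), conj_x h hN hm hn', mul_assoc,
        ← mul_assoc (x r B N α' _),
        (isSteinbergOn_x.commute trivial trivial (by omega) _ _ : Commute (x r B N α' _)
          (x r B N n _)).eq, mul_assoc, ← mul_assoc (x r B N n _), ← isSteinbergOn_x.map_add trivial]
      -- The contribution of `conj β` to x_(α+i) cancels that of `conj κ` to x_i, in the root
      -- subgroup of n = α + β + i.
      have : N β α' • d • N α i • c • p + N κ i • (N α β • (c * d)) • p = 0 := by
        rw [smul_comm d (N α i), smul_smul, smul_assoc (N α β), smul_smul (N κ i), mul_smul c d,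
          smul_comm c d, ← add_smul,
          show N β α' * N α i + N κ i * N α β = 0 by linear_combination -hjac, zero_smul]
      rw [this, show x r B N n (0 : m) = 1 by
        rw [← left_eq_mul (a := x r B N n 0), ← isSteinbergOn_x.map_add trivial, add_zero], one_mul]
    · rw [conj_x_of_nonneg h hN hm (i := α') (by omega),
        conj_x_of_nonneg h hN hm (i := α') (by omega), conj_x_of_nonneg h hN hm (i := i) (by omega)]
  · rw [conj_x_of_nonneg h hN hm hα0]
    obtain hβ1 | hβ0 : B β i = -1 ∨ 0 ≤ B β i := by omega
    · obtain ⟨β', hβ'⟩ := h.exists_add hβ1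
      have f1 := h.add_right hβ' α
      have f2 := h.add_right hβ' κ
      rw [conj_x h hN hm hβ', map_mul, map_mul, conj_x_of_nonneg h hN hm hα0,
        conj_x_of_nonneg h hN hm (α := κ) (i := β') (by omega)]
      obtain h0 | h1 : B α i = 0 ∨ 1 ≤ B α i := by omega
      · obtain ⟨n, hn⟩ := h.exists_add (i := α) (j := β') (by omega)
        have hn' : r n = r κ + r i := by rw [hn, hβ', hκ]; abel
        have hjac := hN.jacobi hκ hβ' hn' h0
        have f3 := h.add_right hn β'
        have f4 := h.symm β' α
        have f5 := h.self β'
        rw [conj_x h hN hm hn, conj_x h hN hm hn', ← mul_assoc,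
          (isSteinbergOn_x.commute trivial trivial (by omega) _ _ : Commute (x r B N β' _)
            (x r B N n _)).eq]
        congr 3
        rw [smul_smul_smul_smul, smul_assoc (N α β), smul_smul (N κ i),
          show N α β' * N β i = N κ i * N α β by linear_combination -hjac]
      · rw [conj_x_of_nonneg h hN hm (i := β') (by omega),
          conj_x_of_nonneg h hN hm (i := i) (by omega)]
    · rw [conj_x_of_nonneg h hN hm hβ0, conj_x_of_nonneg h hN hm hα0,
        conj_x_of_nonneg h hN hm (by omega)]

theorem isSteinbergOn_conjAut :
    IsSteinbergOn r B N (fun _ => True)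
      (conjAut h hN hm : ι → C → MulAut (NonUnitalSt r B N m)) where
  map_add {i} _ c d := by
    ext1 s
    exact (DFunLike.congr_fun (conj_comp_conj h hN hm i c d) s).symm
  comm {i j k} _ _ _ hk c d := by
    rw [commutator_eq_iff]
    ext1 s
    exact DFunLike.congr_fun (conj_comp_conj_of_add h hN hm hk c d) s
  commute {i j} _ _ hij c d := by
    ext1 s
    exact DFunLike.congr_fun (conj_comp_conj_of_nonneg h hN hm hij c d) s

end NonUnitalSt

end Conjugation

end NonUnital

end RelSteinberg

/-! ### Lifting of homomorphisms from the Steinberg group. -/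

namespace RelSteinberg

set_option linter.unusedSectionVars false

open scoped commutatorElement

section

variable {ι V V' G : Type*} [AddCommGroup V] [Module ℝ V] [AddCommGroup V'] [Module ℝ V'] [Group G]
  {Φ : RootPairing ι ℝ V V'} {B N : ι → ι → ℤ} {R S : Type*} [CommRing R] [CommRing S]
  (h : SimplyLacedForm Φ.root B)

namespace St

include h in
theorem isSteinbergOn_x : IsSteinbergOn Φ.root B N (fun _ => True)
    (x Φ N : ι → R → St Φ N R) where
  map_add _ p q := (x_add _ p q).symm
  comm _ _ _ hk p q := by rw [commutatorElement_def, x_comm hk, zsmul_eq_mul]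
  commute {i j} _ _ hij p q := by
    rw [← commutatorElement_eq_one_iff_commute, commutatorElement_def]
    refine x_comm_one (fun k hk => ?_) (fun h0 => ?_) p q
    · have := h.eq_neg_one hk; omega
    · have := h.eq_neg_two_iff.2 h0; omega

/-- The homomorphism defined by a family satisfying the Steinberg relations. -/
def lift {x' : ι → R → G} (hx : IsSteinbergOn Φ.root B N (fun _ => True) x') : St Φ N R →* G :=
  PresentedGroup.toGroup (f := fun p : ι × R => x' p.1 p.2) (by
    rintro w (⟨i, p, q⟩ | ⟨i, j, k, p, q, hk⟩ | ⟨i, j, p, q, hij, h0⟩)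
    · simp [hx.map_add]
    · have := hx.comm trivial trivial trivial hk p q
      rw [commutatorElement_def, zsmul_eq_mul] at this
      simp [this]
    · have h1 : 0 ≤ B i j := by
        have e1 := h.neg_two_le i j
        have e2 : B i j ≠ -2 := fun h1 => h0 (h.eq_neg_two_iff.1 h1)
        have e3 : B i j ≠ -1 := fun h1 => by
          obtain ⟨k, hk⟩ := h.exists_add h1
          exact hij k hk
        omega
      have := commutatorElement_eq_one_iff_commute.2 (hx.commute trivial trivial h1 p q)
      rw [commutatorElement_def] at this
      simpa using this)

@[simp]
theorem lift_x {x' : ι → R → G} (hx : IsSteinbergOn Φ.root B N (fun _ => True) x') (i : ι)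
    (p : R) : lift h hx (x Φ N i p) = x' i p :=
  PresentedGroup.toGroup.of _

@[simp]
theorem map_x (f : R →+* S) (i : ι) (p : R) : map Φ N f (x Φ N i p) = x Φ N i (f p) :=
  PresentedGroup.toGroup.of _

theorem hom_ext {f g : St Φ N R →* G} (hfg : ∀ i p, f (x Φ N i p) = g (x Φ N i p)) : f = g :=
  PresentedGroup.ext fun p => hfg p.1 p.2

theorem induction {P : St Φ N R → Prop} (hx : ∀ i p, P (x Φ N i p)) (h1 : P 1)
    (hmul : ∀ s t, P s → P t → P (s * t)) (hinv : ∀ s, P s → P s⁻¹) (s : St Φ N R) : P s := by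
  have hs : s ∈ Subgroup.closure (Set.range (PresentedGroup.of (α := ι × R)
      (rels := {w | Relator Φ N R w}))) := by
    rw [PresentedGroup.closure_range_of]; trivial
  induction hs using Subgroup.closure_induction with
  | mem w hw => obtain ⟨p, rfl⟩ := hw; exact hx p.1 p.2
  | one => exact h1
  | mul s t _ _ hs ht => exact hmul s t hs ht
  | inv s _ hs => exact hinv s hs

theorem map_comp_apply {T : Type*} [CommRing T] (f : R →+* S) (g : S →+* T) (s : St Φ N R) :
    map Φ N g (map Φ N f s) = map Φ N (g.comp f) s := by
  have : (map Φ N g).comp (map Φ N f) = map Φ N (g.comp f) := hom_ext fun i p => by simp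
  exact DFunLike.congr_fun this s

theorem map_id_apply (s : St Φ N R) : map Φ N (RingHom.id R) s = s := by
  have : map Φ N (RingHom.id R) = MonoidHom.id _ := hom_ext fun i p => by simp
  exact DFunLike.congr_fun this s

variable {κ W W' : Type*} [AddCommGroup W] [Module ℝ W] [AddCommGroup W'] [Module ℝ W']
  {Ψ : RootPairing κ ℝ W W'} (f : Embedding Ψ Φ) (hΦ : IsSimplyLaced Φ)

@[simp]
theorem ofEmbedding_x (i : κ) (p : R) :
    ofEmbedding f hΦ N R (x Ψ (f.restrict N) i p) = x Φ N (f.toIndex i) p :=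
  PresentedGroup.toGroup.of _

theorem map_ofEmbedding (g : R →+* S) (s : St Ψ (f.restrict N) R) :
    map Φ N g (ofEmbedding f hΦ N R s) =
      ofEmbedding f hΦ N S (map Ψ (f.restrict N) g s) := by
  have : (map Φ N g).comp (ofEmbedding f hΦ N R) =
    (ofEmbedding f hΦ N S).comp (map Ψ (f.restrict N) g) := hom_ext fun i p => by simp
  exact DFunLike.congr_fun this s

theorem map_mem_range_ofEmbedding (g : R →+* S) {s : St Φ N R}
    (hs : s ∈ (ofEmbedding f hΦ N R).range) :
    map Φ N g s ∈ (ofEmbedding f hΦ N S).range := by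
  obtain ⟨t, rfl⟩ := hs
  exact ⟨_, (map_ofEmbedding f hΦ g t).symm⟩

end St

/-! ### Augmented rings and the semidirect product. -/

section Semidirect

variable {m C L : Type*} [NonUnitalCommRing m] [CommRing C] [CommRing L] [Module C m]
  [IsScalarTower C m m] [SMulCommClass C m m]
  (hN : StructureConstants Φ.root B N) (hm : HasRegularFactors m)

/-- The action of the Steinberg group of `C` on the Steinberg group of a non-unital `C`-algebra. -/
noncomputable def NonUnitalSt.action : St Φ N C →* MulAut (NonUnitalSt Φ.root B N m) :=
  St.lift h (NonUnitalSt.isSteinbergOn_conjAut h hN hm)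

@[simp]
theorem NonUnitalSt.action_x (i : ι) (c : C) (s : NonUnitalSt Φ.root B N m) :
    action h hN hm (St.x Φ N i c) s = conj h hN hm i c s := by
  rw [action, St.lift_x]; rfl

/-- A ring `L` augmented over `C` whose augmentation ideal is mapped to the `C`-algebra `m`: the
value of `toFun` at `f` is the image of `f - ε f`. -/
structure AugmentationMap (ε : L →+* C) (m : Type*) [NonUnitalCommRing m] [Module C m] where
  toFun : L →+ m
  map_mul : ∀ f g, toFun (f * g) = toFun f * toFun g + ε f • toFun g + ε g • toFun f

variable {ε : L →+* C} (η : AugmentationMap ε m)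

-- The element attached to f is a(η f) b(ε f), with b acting on a by `conj`. In the commutator of
-- two such elements the a-parts contribute exactly the three terms of `η.map_mul`, and the b-parts
-- contribute ε f · ε g.
open SemidirectProduct in
theorem NonUnitalSt.isSteinbergOn_semidirect :
    IsSteinbergOn Φ.root B N (fun _ => True) (fun i f =>
      (inl (NonUnitalSt.x Φ.root B N i (η.toFun f)) * inr (St.x Φ N i (ε f)) :
        NonUnitalSt Φ.root B N m ⋊[action h hN hm] St Φ N C)) := by
  let a : ι → m → NonUnitalSt Φ.root B N m ⋊[action h hN hm] St Φ N C :=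
    fun i p => inl (NonUnitalSt.x Φ.root B N i p)
  let b : ι → C → NonUnitalSt Φ.root B N m ⋊[action h hN hm] St Φ N C :=
    fun i c => inr (St.x Φ N i c)
  have ha_add : ∀ i p q, a i (p + q) = a i p * a i q := fun i p q => by
    simp only [a, NonUnitalSt.isSteinbergOn_x.map_add trivial, map_mul]
  have hb_add : ∀ i c d, b i (c + d) = b i c * b i d := fun i c d => by
    simp only [b, (St.isSteinbergOn_x h).map_add trivial, map_mul]
  have ha_comm : ∀ {i j k}, Φ.root k = Φ.root i + Φ.root j →
      ∀ p q, ⁅a i p, a j q⁆ = a k (N i j • (p * q)) := fun hk p q => by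
    simp only [a, ← map_commutatorElement, NonUnitalSt.isSteinbergOn_x.comm trivial trivial
      trivial hk]
  have hb_comm : ∀ {i j k}, Φ.root k = Φ.root i + Φ.root j →
      ∀ p q, ⁅b i p, b j q⁆ = b k (N i j • (p * q)) := fun hk p q => by
    simp only [b, ← map_commutatorElement, (St.isSteinbergOn_x h).comm trivial trivial
      trivial hk]
  have ha : ∀ {i j}, 0 ≤ B i j → ∀ p q, Commute (a i p) (a j q) := fun hij p q =>
    (NonUnitalSt.isSteinbergOn_x.commute trivial trivial hij p q).map inl
  have hb : ∀ {i j}, 0 ≤ B i j → ∀ p q, Commute (b i p) (b j q) := fun hij p q =>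
    ((St.isSteinbergOn_x h).commute trivial trivial hij p q).map inr
  have hconj : ∀ i j c p, b i c * a j p * (b i c)⁻¹ =
      inl (conj h hN hm i c (NonUnitalSt.x Φ.root B N j p)) := fun i j c p => by
    rw [← action_x, inl_aut]
    simp only [a, b, map_inv]
  have hba : ∀ {i j}, 0 ≤ B i j → ∀ c p, Commute (b i c) (a j p) := fun {i j} hij c p => by
    have := hconj i j c p
    rw [conj_x_of_nonneg h hN hm hij] at this
    exact mul_inv_eq_iff_eq_mul.1 this
  have hba_comm : ∀ {i j k}, Φ.root k = Φ.root i + Φ.root j →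
      ∀ c q, ⁅b i c, a j q⁆ = a k (N i j • c • q) := fun {i j k} hk c q => by
    rw [commutatorElement_def, hconj, conj_x h hN hm hk, map_mul]
    exact mul_inv_cancel_right _ _
  have ha_neg : ∀ i p, a i (-p) = (a i p)⁻¹ := fun i => map_neg_of_map_add (ha_add i)
  have hab_comm : ∀ {i j k}, Φ.root k = Φ.root i + Φ.root j →
      ∀ p d, ⁅a i p, b j d⁆ = a k (N i j • d • p) := fun {i j k} hk p d => by
    rw [← commutatorElement_inv, hba_comm (by rw [hk, add_comm]), hN.antisymm hk, neg_smul, ha_neg,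
      inv_inv]
  refine ⟨fun {i} _ f g => ?_, fun {i j k} _ _ _ hk f g => ?_, fun {i j} _ _ hij f g => ?_⟩
  · change a i (η.toFun (f + g)) * b i (ε (f + g)) =
      a i (η.toFun f) * b i (ε f) * (a i (η.toFun g) * b i (ε g))
    have hc := hba (i := i) (j := i) (by rw [h.self]; omega) (ε f) (η.toFun g)
    rw [map_add, map_add, ha_add, hb_add, mul_assoc, mul_assoc, ← mul_assoc (b i _), hc.eq,
      mul_assoc]
  · change ⁅a i (η.toFun f) * b i (ε f), a j (η.toFun g) * b j (ε g)⁆ =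
      a k (η.toFun (N i j • (f * g))) * b k (ε (N i j • (f * g)))
    have e1 := h.eq_neg_one hk
    have e2 := h.add_left hk i
    have e3 := h.add_left hk j
    have e4 := h.self i
    have e5 := h.self j
    have e6 := h.symm i j
    have e7 := h.symm i k
    have h1 : ⁅b i (ε f), a j (η.toFun g) * b j (ε g)⁆ =
        a k (N i j • ε f • η.toFun g) * b k (N i j • (ε f * ε g)) := by
      rw [commutator_mul_right_of_commute, hba_comm hk, hb_comm hk]
      rw [hb_comm hk]
      exact (hba (by omega) _ _).symm
    have h2 : ⁅a i (η.toFun f), a j (η.toFun g) * b j (ε g)⁆ =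
        a k (N i j • (η.toFun f * η.toFun g)) * a k (N i j • ε g • η.toFun f) := by
      rw [commutator_mul_right_of_commute, ha_comm hk, hab_comm hk]
      rw [hab_comm hk]
      exact ha (by rw [h.symm]; omega) _ _
    have h3 : Commute (a i (η.toFun f)) ⁅b i (ε f), a j (η.toFun g) * b j (ε g)⁆ := by
      rw [h1]
      exact (ha (by omega) _ _).mul_right (hba (by omega) _ _).symm
    rw [commutator_mul_left_of_commute h3, h1, h2, map_zsmul, map_zsmul, map_mul ε, η.map_mul,
      mul_assoc, ← ha_add, (hba (i := k) (j := k) (by rw [h.self]; omega) _ _).eq, ← mul_assoc,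
      ← ha_add, ← smul_add, ← smul_add]
    congr 3
    abel
  · change Commute (a i (η.toFun f) * b i (ε f)) (a j (η.toFun g) * b j (ε g))
    exact ((ha hij _ _).mul_right (hba (by rw [h.symm]; exact hij) _ _).symm).mul_left
      ((hba hij _ _).mul_right (hb hij _ _))

/-- The homomorphism `St(L) → St(m) ⋊ St(C)` induced by an augmentation map. -/
noncomputable def NonUnitalSt.toSemidirect :
    St Φ N L →* NonUnitalSt Φ.root B N m ⋊[action h hN hm] St Φ N C :=
  St.lift h (isSteinbergOn_semidirect h hN hm η)

theorem NonUnitalSt.toSemidirect_x (i : ι) (f : L) :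
    toSemidirect h hN hm η (St.x Φ N i f) =
      ⟨NonUnitalSt.x Φ.root B N i (η.toFun f), St.x Φ N i (ε f)⟩ := by
  rw [toSemidirect, St.lift_x, SemidirectProduct.mk_eq_inl_mul_inr]

theorem NonUnitalSt.toSemidirect_right (s : St Φ N L) :
    (toSemidirect h hN hm η s).right = St.map Φ N ε s := by
  have : SemidirectProduct.rightHom.comp (toSemidirect h hN hm η) = St.map Φ N ε :=
    St.hom_ext fun i f => by simp [toSemidirect_x]
  exact DFunLike.congr_fun this s

/-! ### The subgroup of a subsystem and its stability under conjugation. -/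

section Subsystem

variable {κ W W' : Type*} [AddCommGroup W] [Module ℝ W] [AddCommGroup W'] [Module ℝ W']
  {Ψ : RootPairing κ ℝ W W'} {BΨ : κ → κ → ℤ} (hΨ : SimplyLacedForm Ψ.root BΨ)
  (f : Embedding Ψ Φ) (hB : ∀ k l, B (f.toIndex k) (f.toIndex l) = BΨ k l)

variable (B N m) in
/-- The subgroup generated by the root elements of a subsystem. -/
def NonUnitalSt.sub : Subgroup (NonUnitalSt Φ.root B N m) :=
  Subgroup.closure {s | ∃ k p, s = NonUnitalSt.x Φ.root B N (f.toIndex k) p}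

theorem _root_.RelSteinberg.Embedding.root_add {i j k : κ} (hk : Ψ.root k = Ψ.root i + Ψ.root j) :
    Φ.root (f.toIndex k) = Φ.root (f.toIndex i) + Φ.root (f.toIndex j) := by
  simp only [f.root_toIndex, hk, map_add]

theorem NonUnitalSt.x_mem_sub (k : κ) (p : m) :
    NonUnitalSt.x Φ.root B N (f.toIndex k) p ∈ sub B N m f :=
  Subgroup.subset_closure ⟨k, p, rfl⟩

-- The formula for `conj` stays inside the subsystem. For the root -α, where there is no formula, a
-- decomposition into two roots of the subsystem is used.
include hΨ hB in
theorem NonUnitalSt.conj_mem_sub (α : κ) (c : C) {s : NonUnitalSt Φ.root B N m}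
    (hs : s ∈ sub B N m f) : conj h hN hm (f.toIndex α) c s ∈ sub B N m f := by
  have key : ∀ k, BΨ α k ≠ -2 → ∀ p : m,
      conj h hN hm (f.toIndex α) c (x Φ.root B N (f.toIndex k) p) ∈ sub B N m f := by
    intro k hk p
    have e1 := hΨ.neg_two_le α k
    obtain e | e : BΨ α k = -1 ∨ 0 ≤ BΨ α k := by omega
    · obtain ⟨l, hl⟩ := hΨ.exists_add e
      rw [conj_x h hN hm (f.root_add hl)]
      exact mul_mem (x_mem_sub f _ _) (x_mem_sub f _ _)
    · rw [conj_x_of_nonneg h hN hm (by rw [hB]; exact e)]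
      exact x_mem_sub f _ _
  suffices sub B N m f ≤ (sub B N m f).comap (conj h hN hm (f.toIndex α) c) from this hs
  refine (Subgroup.closure_le _).2 ?_
  rintro _ ⟨k, p, rfl⟩
  rw [SetLike.mem_coe, Subgroup.mem_comap]
  by_cases hk : BΨ α k = -2
  · obtain ⟨i, j, hij⟩ := hΨ.exists_split k
    obtain ⟨hi, hj⟩ := hΨ.ne_neg_two_of_add hij hk
    obtain ⟨a, b, hab⟩ := exists_x_eq_commutator hN hm (f.root_add hij) p
    rw [hab, map_commutatorElement, commutatorElement_def]
    exact mul_mem (mul_mem (mul_mem (key i hi a) (key j hj b)) (inv_mem (key i hi a)))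
      (inv_mem (key j hj b))
  · exact key k hk p

include hΨ hB in
theorem NonUnitalSt.toSemidirect_left_mem_sub (hΦ : IsSimplyLaced Φ)
    (s : St Ψ (f.restrict N) L) :
    (toSemidirect h hN hm η (St.ofEmbedding f hΦ N L s)).left ∈ sub B N m f := by
  -- The condition on the left component is not multiplicative by itself; the right component must
  -- also preserve the subgroup, together with its inverse.
  let K : Subgroup (NonUnitalSt Φ.root B N m ⋊[action h hN hm] St Φ N C) :=
    { carrier := {z | z.left ∈ sub B N m f ∧ ∀ t ∈ sub B N m f,
        action h hN hm z.right t ∈ sub B N m f ∧ action h hN hm z.right⁻¹ t ∈ sub B N m f}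
      mul_mem' := by
        rintro a b ⟨ha1, ha2⟩ ⟨hb1, hb2⟩
        refine ⟨mul_mem ha1 (ha2 _ hb1).1, fun t ht => ⟨?_, ?_⟩⟩
        · rw [SemidirectProduct.mul_right, map_mul]
          exact (ha2 _ (hb2 t ht).1).1
        · rw [SemidirectProduct.mul_right, mul_inv_rev, map_mul]
          exact (hb2 _ (ha2 t ht).2).2
      one_mem' := by
        refine ⟨one_mem _, fun t ht => ⟨?_, ?_⟩⟩
        · rw [SemidirectProduct.one_right, map_one]; exact ht
        · rw [SemidirectProduct.one_right, inv_one, map_one]; exact ht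
      inv_mem' := by
        rintro a ⟨ha1, ha2⟩
        refine ⟨(ha2 _ (inv_mem ha1)).2, fun t ht => ⟨?_, ?_⟩⟩
        · rw [SemidirectProduct.inv_right]; exact (ha2 t ht).2
        · rw [SemidirectProduct.inv_right, inv_inv]; exact (ha2 t ht).1 }
  suffices toSemidirect h hN hm η (St.ofEmbedding f hΦ N L s) ∈ K from this.1
  refine St.induction (P := fun s => toSemidirect h hN hm η (St.ofEmbedding f hΦ N L s) ∈ K)
    (fun i p => ?_) (by rw [map_one, map_one]; exact one_mem _)
    (fun s t hs ht => by rw [map_mul, map_mul]; exact mul_mem hs ht)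
    (fun s hs => by rw [map_inv, map_inv]; exact inv_mem hs) s
  rw [St.ofEmbedding_x, toSemidirect_x]
  refine ⟨x_mem_sub f _ _, fun t ht => ⟨?_, ?_⟩⟩
  · rw [action_x]
    exact conj_mem_sub h hN hm hΨ f hB i _ ht
  · have : (St.x Φ N (f.toIndex i) (ε p))⁻¹ = St.x Φ N (f.toIndex i) (-ε p) :=
      (map_neg_of_map_add (fun p q => (St.x_add (Φ := Φ) (N := N) (f.toIndex i) p q).symm) _).symm
    rw [this, action_x]
    exact conj_mem_sub h hN hm hΨ f hB i _ ht

end Subsystem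

/-! ### Evaluation in germs of families of Steinberg group elements. -/

section Germs

open Filter

variable {Z : Type*} {F : Filter Z}

include h in
/-- Root elements with germs of functions as arguments. -/
theorem St.isSteinbergOn_germ : IsSteinbergOn Φ.root B N (fun _ => True)
    (fun i (p : Germ F R) => p.map (St.x Φ N i)) where
  map_add {i} _ p q := by
    induction p, q using Germ.inductionOn₂ with
    | _ p q =>
      rw [← Germ.coe_add, Germ.map_coe, Germ.map_coe, Germ.map_coe, ← Germ.coe_mul]
      congr 1
      exact funext fun z => (St.x_add i _ _).symm
  comm {i j k} _ _ _ hk p q := by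
    induction p, q using Germ.inductionOn₂ with
    | _ p q =>
      rw [commutatorElement_def]
      change _ = Germ.map _ (Germ.ofFun (N i j • (p * q)))
      simp only [Germ.map_coe, ← Germ.coe_mul, ← Germ.coe_inv]
      congr 1
      exact funext fun z => (St.isSteinbergOn_x h).comm trivial trivial trivial hk (p z) (q z)
  commute {i j} _ _ hij p q := by
    induction p, q using Germ.inductionOn₂ with
    | _ p q =>
      rw [Commute, SemiconjBy]
      simp only [Germ.map_coe, ← Germ.coe_mul]
      congr 1
      exact funext fun z => ((St.isSteinbergOn_x h).commute trivial trivial hij (p z) (q z)).eq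

theorem IsSteinbergOn.comp {m' : Type*} [NonUnitalCommRing m'] {x : ι → m' → G}
    (hx : IsSteinbergOn Φ.root B N (fun _ => True) x) (ρ : m →ₙ+* m') :
    IsSteinbergOn Φ.root B N (fun _ => True) (fun i p => x i (ρ p)) where
  map_add {i} hi p q := (congrArg (x i) (_root_.map_add ρ p q)).trans (hx.map_add hi _ _)
  comm hi hj hk hijk p q := by rw [hx.comm hi hj hk hijk, map_zsmul, map_mul]
  commute hi hj hij p q := hx.commute hi hj hij _ _

variable (ρ : m →ₙ+* Germ F R)

/-- The homomorphism from the Steinberg group of `m` to germs of functions with values in the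
Steinberg group of `R`. -/
def NonUnitalSt.toGerm : NonUnitalSt Φ.root B N m →* Germ F (St Φ N R) :=
  NonUnitalSt.lift ((St.isSteinbergOn_germ h).comp ρ)

@[simp]
theorem NonUnitalSt.toGerm_x (i : ι) (p : m) :
    toGerm h ρ (x Φ.root B N i p) = (ρ p).map (St.x Φ N i) :=
  lift_x _ i p

variable {A : Type*} [CommRing A] (c : A →+* C) (d : A →+* R)
  (hρ : ∀ a p, ρ (c a • p) = ((d a : R) : Germ F R) * ρ p)

include hρ in
/-- The homomorphism `toGerm` respects the actions of the Steinberg group of `A`. -/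
theorem NonUnitalSt.toGerm_action (s : St Φ N A) (t : NonUnitalSt Φ.root B N m) :
    toGerm h ρ (action h hN hm (St.map Φ N c s) t) =
      ((St.map Φ N d s : St Φ N R) : Germ F (St Φ N R)) * toGerm h ρ t *
        ((St.map Φ N d s : St Φ N R) : Germ F (St Φ N R))⁻¹ := by
  revert t
  refine St.induction (P := fun s => ∀ t, toGerm h ρ (action h hN hm (St.map Φ N c s) t) =
      ((St.map Φ N d s : St Φ N R) : Germ F (St Φ N R)) * toGerm h ρ t *
        ((St.map Φ N d s : St Φ N R) : Germ F (St Φ N R))⁻¹)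
    (fun α a t => ?_) (fun t => ?_) (fun s s' hs hs' t => ?_) (fun s hs t => ?_) s
  · have : (toGerm h ρ).comp (conj h hN hm α (c a)) =
        (MulAut.conj (((St.x Φ N α (d a) : St Φ N R) : Germ F (St Φ N R)))).toMonoidHom.comp
          (toGerm h ρ) := by
      refine hom_ext_of_ne_neg α α h hN hm fun i hi _ p => ?_
      have hY := St.isSteinbergOn_germ (F := F) (N := N) (R := R) h
      have hconst : ((St.x Φ N α (d a) : St Φ N R) : Germ F (St Φ N R)) =
        ((d a : R) : Germ F R).map (St.x Φ N α) := rfl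
      have e1 := h.neg_two_le α i
      simp only [MonoidHom.comp_apply, MulEquiv.coe_toMonoidHom, MulAut.conj_apply, toGerm_x]
      rw [eq_mul_inv_iff_mul_eq, hconst]
      obtain e | e : B α i = -1 ∨ 0 ≤ B α i := by omega
      · obtain ⟨k, hk⟩ := h.exists_add e
        rw [conj_x h hN hm hk, map_mul, toGerm_x, toGerm_x, map_zsmul, hρ]
        exact (commutator_eq_iff.1 (hY.comm trivial trivial trivial hk _ _)).symm
      · rw [conj_x_of_nonneg h hN hm e, toGerm_x]
        exact (hY.commute trivial trivial e _ _).eq.symm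
    have := DFunLike.congr_fun this t
    simpa using this
  · rw [map_one, map_one, map_one, MulAut.one_apply]
    change _ = 1 * _ * 1⁻¹
    group
  · rw [map_mul, map_mul, MulAut.mul_apply, hs, hs', map_mul,
      show ((St.map Φ N d s * St.map Φ N d s' : St Φ N R) : Germ F (St Φ N R)) =
        (St.map Φ N d s : St Φ N R) * (St.map Φ N d s' : St Φ N R) from rfl]
    group
  · have := hs (action h hN hm (St.map Φ N c s⁻¹) t)
    rw [← MulAut.mul_apply, ← map_mul, ← map_mul, mul_inv_cancel, map_one, map_one,
      MulAut.one_apply] at this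
    rw [this, map_inv (St.map Φ N d), Germ.const_inv]
    group

variable (lam : R →+* L) (e : R →+* A) (hce : ∀ f, ε (lam f) = c (e f))
  (θ : Z → R →+* R)
  (hθ : ∀ f, ρ (η.toFun (lam f)) + ((d (e f) : R) : Germ F R) = ((fun z => θ z f : Z → R) : Germ F R))

-- The left component plays the role of s(TX) s(0)⁻¹, and multiplying by s(0) restores s(TX), with T
-- specialized along the filter. `toGerm_action` makes this identity compatible with products, the
-- left component being only a crossed homomorphism.
include hce hθ hρ in
theorem NonUnitalSt.toGerm_toSemidirect (s : St Φ N R) :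
    toGerm h ρ (toSemidirect h hN hm η (St.map Φ N lam s)).left *
      ((St.map Φ N d (St.map Φ N e s) : St Φ N R) : Germ F (St Φ N R)) =
      ((fun z => St.map Φ N (θ z) s : Z → St Φ N R) : Germ F (St Φ N R)) := by
  have hright : ∀ s, (toSemidirect h hN hm η (St.map Φ N lam s)).right =
      St.map Φ N c (St.map Φ N e s) := fun s => by
    rw [toSemidirect_right, St.map_comp_apply, St.map_comp_apply]
    congr 2
    exact RingHom.ext hce
  refine St.induction (P := fun s => toGerm h ρ (toSemidirect h hN hm η (St.map Φ N lam s)).left *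
      ((St.map Φ N d (St.map Φ N e s) : St Φ N R) : Germ F (St Φ N R)) =
      ((fun z => St.map Φ N (θ z) s : Z → St Φ N R) : Germ F (St Φ N R)))
    (fun i f => ?_) ?_ (fun s t hs ht => ?_) (fun s hs => ?_) s
  · simp only [St.map_x, toSemidirect_x, toGerm_x]
    change _ * ((d (e f) : R) : Germ F R).map (St.x Φ N i) = _
    rw [← (St.isSteinbergOn_germ h).map_add trivial, hθ]
    rfl
  · simp only [map_one, SemidirectProduct.one_left]
    rfl
  · have := toGerm_action h hN hm ρ c d hρ (St.map Φ N e s)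
      (toSemidirect h hN hm η (St.map Φ N lam t)).left
    simp only [map_mul, SemidirectProduct.mul_left, hright]
    rw [this, show (((fun z => St.map Φ N (θ z) s * St.map Φ N (θ z) t : Z → St Φ N R)) :
      Germ F (St Φ N R)) = ((fun z => St.map Φ N (θ z) s : Z → St Φ N R) : Germ F (St Φ N R)) *
        ((fun z => St.map Φ N (θ z) t : Z → St Φ N R) : Germ F (St Φ N R)) from rfl, ← hs, ← ht,
      show ((St.map Φ N d (St.map Φ N e s) * St.map Φ N d (St.map Φ N e t) : St Φ N R) :
        Germ F (St Φ N R)) = (St.map Φ N d (St.map Φ N e s) : St Φ N R) *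
          (St.map Φ N d (St.map Φ N e t) : St Φ N R) from rfl]
    group
  · have h1 := toGerm_action h hN hm ρ c d hρ (St.map Φ N e s)⁻¹
      (toSemidirect h hN hm η (St.map Φ N lam s)).left⁻¹
    simp only [map_inv, SemidirectProduct.inv_left, hright] at h1 ⊢
    rw [h1, show (((fun z => (St.map Φ N (θ z) s)⁻¹ : Z → St Φ N R)) :
      Germ F (St Φ N R)) = ((fun z => St.map Φ N (θ z) s : Z → St Φ N R) : Germ F (St Φ N R))⁻¹
      from rfl, ← hs, Germ.const_inv]
    group

variable {κ W W' : Type*} [AddCommGroup W] [Module ℝ W] [AddCommGroup W'] [Module ℝ W']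
  {Ψ : RootPairing κ ℝ W W'} {BΨ : κ → κ → ℤ} (hΨ : SimplyLacedForm Ψ.root BΨ)
  (f : Embedding Ψ Φ) (hB : ∀ k l, B (f.toIndex k) (f.toIndex l) = BΨ k l)

include h hN hm hρ hce hθ hΨ hB in
/-- If an element of `St(R)` that becomes trivial in `St(A)` is mapped to the image of `St(Ψ, L)`,
then almost all of its dilations come from `St(Ψ, R)`. -/
theorem St.eventually_map_mem_range (hΦ : IsSimplyLaced Φ) {s : St Φ N R}
    (hs : St.map Φ N e s = 1)
    (hs' : St.map Φ N lam s ∈ (St.ofEmbedding f hΦ N L).range) :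
    ∀ᶠ z in F, St.map Φ N (θ z) s ∈ (St.ofEmbedding f hΦ N R).range := by
  obtain ⟨t, ht⟩ := hs'
  have h1 := NonUnitalSt.toGerm_toSemidirect h hN hm η ρ c d hρ lam e hce θ hθ s
  rw [hs, map_one, show ((1 : St Φ N R) : Germ F (St Φ N R)) = 1 from rfl, mul_one, ← ht] at h1
  have h2 := NonUnitalSt.toSemidirect_left_mem_sub h hN hm η hΨ f hB hΦ t
  -- Lying in the image for almost all z defines a subgroup of germs, so only the generators of
  -- `sub` need to be tested.
  let Q : Subgroup (Germ F (St Φ N R)) :=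
    { carrier := {g | g.LiftPred (· ∈ (St.ofEmbedding f hΦ N R).range)}
      mul_mem' := by
        intro a b
        induction a, b using Germ.inductionOn₂ with
        | _ a b =>
          intro ha hb
          filter_upwards [Germ.liftPred_coe.1 ha, Germ.liftPred_coe.1 hb] with z h1 h2
            using mul_mem h1 h2
      one_mem' := Germ.liftPred_const (one_mem _)
      inv_mem' := by
        intro a
        induction a using Germ.inductionOn with
        | _ a =>
          intro ha
          filter_upwards [Germ.liftPred_coe.1 ha] with z h1 using inv_mem h1 }
  have h3 : NonUnitalSt.sub B N m f ≤ Q.comap (NonUnitalSt.toGerm h ρ) := by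
    refine (Subgroup.closure_le _).2 ?_
    rintro _ ⟨k, p, rfl⟩
    rw [SetLike.mem_coe, Subgroup.mem_comap, NonUnitalSt.toGerm_x]
    induction ρ p using Germ.inductionOn with
    | _ g => exact Filter.Eventually.of_forall fun z => ⟨_, St.ofEmbedding_x f hΦ k (g z)⟩
  have h4 := h3 h2
  rw [Subgroup.mem_comap, h1] at h4
  exact Germ.liftPred_coe.1 h4

end Germs

end Semidirect

end

end RelSteinberg

/-! ### Positive rational powers as regular factors. -/

namespace RelSteinberg

set_option linter.unusedSectionVars false

/-- The positive rational numbers, used as exponents. -/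
abbrev PosRat : Type := {q : ℚ // 0 < q}

namespace PosRat

theorem exists_add_add (p q : PosRat) : ∃ e a b : PosRat, p = e + a ∧ q = e + b := by
  obtain ⟨p, hp⟩ := p
  obtain ⟨q, hq⟩ := q
  have h0 : 0 < min p q / 2 := half_pos (lt_min hp hq)
  have h1 : min p q / 2 < p := (half_lt_self (lt_min hp hq)).trans_le (min_le_left _ _)
  have h2 : min p q / 2 < q := (half_lt_self (lt_min hp hq)).trans_le (min_le_right _ _)
  exact ⟨⟨_, h0⟩, ⟨p - min p q / 2, sub_pos.2 h1⟩, ⟨q - min p q / 2, sub_pos.2 h2⟩,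
    Subtype.ext (by push_cast; ring), Subtype.ext (by push_cast; ring)⟩

end PosRat

section Factors

open AddMonoidAlgebra

variable {L : Type*} [CommRing L]

theorem single_one_mul_cancel (e : PosRat) {a b : AddMonoidAlgebra L PosRat}
    (h : single e 1 * a = single e 1 * b) : a = b := by
  refine AddMonoidAlgebra.coeff_injective (Finsupp.ext fun q => ?_)
  have key : ∀ c : AddMonoidAlgebra L PosRat, (single e 1 * c).coeff (e + q) = c.coeff q := by
    intro c
    rw [coeff_single_mul_eq_mul_coeff (m₂ := q) (fun m' _ => by simp), one_mul]
  rw [← key, h, key]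

theorem exists_single_one_mul (p : AddMonoidAlgebra L PosRat) :
    ∃ q : PosRat, ∀ e : PosRat, (e : ℚ) < q → ∃ p', p = single e 1 * p' := by
  induction p using AddMonoidAlgebra.induction_linear with
  | zero => exact ⟨⟨1, one_pos⟩, fun e _ => ⟨0, (mul_zero _).symm⟩⟩
  | add p p' hp hp' =>
    obtain ⟨q, hq⟩ := hp
    obtain ⟨q', hq'⟩ := hp'
    refine ⟨⟨min q q', lt_min q.2 q'.2⟩, fun e he => ?_⟩
    obtain ⟨a, ha⟩ := hq e (he.trans_le (min_le_left _ _))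
    obtain ⟨b, hb⟩ := hq' e (he.trans_le (min_le_right _ _))
    exact ⟨a + b, by rw [ha, hb, mul_add]⟩
  | single q f =>
    refine ⟨q, fun e he => ⟨single ⟨q - e, sub_pos.2 he⟩ f, ?_⟩⟩
    rw [single_mul_single, one_mul]
    congr 1
    exact Subtype.ext (by push_cast; ring)

/-- Two elements are both divisible by T^e once e is below all of their exponents, and T^e is
regular because it merely translates exponents. Integral exponents would not do: T is not a product.
-/
theorem hasRegularFactors_addMonoidAlgebra : HasRegularFactors (AddMonoidAlgebra L PosRat) := by
  intro p p'
  obtain ⟨q, hq⟩ := exists_single_one_mul p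
  obtain ⟨q', hq'⟩ := exists_single_one_mul p'
  obtain ⟨e, a, b, ha, hb⟩ := PosRat.exists_add_add q q'
  obtain ⟨u, hu⟩ := hq e (by rw [ha]; push_cast; linarith [a.2])
  obtain ⟨v, hv⟩ := hq' e (by rw [hb]; push_cast; linarith [b.2])
  exact ⟨single e 1, u, v, fun _ _ => single_one_mul_cancel e, hu, hv⟩

end Factors

/-! ### Clearing denominators by infinitely divisible powers. -/

section Denominators

variable {R L 𝒢 : Type*} [CommRing R] [CommRing L] [CommRing 𝒢] [Algebra R L] (M : Submonoid R)
  [IsLocalization M L] (δ : R →+* 𝒢) (σ : PosRat → 𝒢)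

/-- The elements `σ q` behave like positive powers of an element divisible by all of `M`. -/
structure IsDivisiblePower : Prop where
  add_eq_mul : ∀ p q, σ (p + q) = σ p * σ q
  dvd : ∀ q, ∀ v ∈ M, ∃ y, σ q = δ v * y

variable {M δ σ} (hσ : IsDivisiblePower M δ σ)

-- The quotient y of `σ a` by `δ v` need not be unique, since `δ v` may be a zero divisor. Keeping
-- back a factor `σ b` of `σ q = σ a * σ b` repairs this, because `σ b` is itself divisible by every
-- denominator.
include M hσ in
theorem IsDivisiblePower.exists_clear (q : PosRat) (f : L) :
    ∃ g : 𝒢, ∀ (r v : R) (y : 𝒢) (a b : PosRat), v ∈ M →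
      algebraMap R L r = algebraMap R L v * f → a + b = q → σ a = δ v * y →
      g = δ r * y * σ b := by
  obtain ⟨a₀, b₀, -, hq₀, -⟩ := PosRat.exists_add_add q q
  obtain ⟨⟨r₀, v₀, hv₀⟩, hf⟩ := IsLocalization.surj M f
  obtain ⟨y₀, hy₀⟩ := hσ.dvd a₀ v₀ hv₀
  refine ⟨δ r₀ * y₀ * σ b₀, fun r v y a b hv hr hq hy => ?_⟩
  have h1 : algebraMap R L (v * r₀) = algebraMap R L (v₀ * r) := by
    simp only [map_mul] at hf ⊢
    rw [← hf, hr]; ring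
  obtain ⟨⟨w, hw⟩, hc⟩ := (IsLocalization.eq_iff_exists M L).1 h1
  obtain ⟨e, b₁, b₂, rfl, rfl⟩ := PosRat.exists_add_add b₀ b
  -- The common part e of b₀ and b supplies both denominators together with the element w that
  -- witnesses the equality of the two fractions.
  obtain ⟨z, hz⟩ := hσ.dvd e (w * v * v₀) (mul_mem (mul_mem hw hv) hv₀)
  have h2 : a₀ + b₁ = a + b₂ := by
    have : e + (a₀ + b₁) = e + (a + b₂) := by
      rw [add_left_comm, ← hq₀, ← hq, add_left_comm]
    exact add_left_cancel this
  have h3 : σ a₀ * σ b₁ = σ a * σ b₂ := by rw [← hσ.add_eq_mul, h2, hσ.add_eq_mul]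
  have h4 : δ w * (δ v * δ r₀) = δ w * (δ v₀ * δ r) := by
    simp only [← map_mul]; exact congrArg δ hc
  rw [hσ.add_eq_mul, hσ.add_eq_mul, hz]
  simp only [map_mul]
  calc δ r₀ * y₀ * (δ w * δ v * δ v₀ * z * σ b₁)
      = δ w * (δ v * δ r₀) * z * ((δ v₀ * y₀) * σ b₁) := by ring
    _ = δ w * (δ v₀ * δ r) * z * ((δ v * y) * σ b₂) := by rw [h4, ← hy₀, h3, hy]
    _ = δ r * y * (δ w * δ v * δ v₀ * z * σ b₂) := by ring

/-- The map sending a fraction `r / v` to `r (σ q / v)`. -/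
noncomputable def IsDivisiblePower.clear (q : PosRat) (f : L) : 𝒢 :=
  (hσ.exists_clear q f).choose

theorem IsDivisiblePower.clear_eq {q : PosRat} {f : L} {r v : R} {y : 𝒢} {a b : PosRat}
    (hv : v ∈ M) (hr : algebraMap R L r = algebraMap R L v * f) (hq : a + b = q)
    (hy : σ a = δ v * y) : hσ.clear q f = δ r * y * σ b :=
  (hσ.exists_clear q f).choose_spec r v y a b hv hr hq hy

theorem IsDivisiblePower.clear_add (q : PosRat) (f g : L) :
    hσ.clear q (f + g) = hσ.clear q f + hσ.clear q g := by
  obtain ⟨a, b, -, hq, -⟩ := PosRat.exists_add_add q q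
  obtain ⟨⟨r, v, hv⟩, hf⟩ := IsLocalization.surj M f
  obtain ⟨⟨s, w, hw⟩, hg⟩ := IsLocalization.surj M g
  obtain ⟨y, hy⟩ := hσ.dvd a (v * w) (mul_mem hv hw)
  simp only at hf hg
  rw [hσ.clear_eq (f := f) (r := w * r) (mul_mem hv hw) (by simp only [map_mul, ← hf]; ring) hq.symm hy,
    hσ.clear_eq (f := g) (r := v * s) (mul_mem hv hw) (by simp only [map_mul, ← hg]; ring) hq.symm hy,
    hσ.clear_eq (f := f + g) (r := w * r + v * s) (mul_mem hv hw)
      (by simp only [map_mul, map_add, ← hf, ← hg]; ring) hq.symm hy, map_add]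
  ring

theorem IsDivisiblePower.clear_mul (p q : PosRat) (f g : L) :
    hσ.clear (p + q) (f * g) = hσ.clear p f * hσ.clear q g := by
  obtain ⟨a, b, -, hp, -⟩ := PosRat.exists_add_add p p
  obtain ⟨c, d, -, hq, -⟩ := PosRat.exists_add_add q q
  obtain ⟨⟨r, v, hv⟩, hf⟩ := IsLocalization.surj M f
  obtain ⟨⟨s, w, hw⟩, hg⟩ := IsLocalization.surj M g
  obtain ⟨y, hy⟩ := hσ.dvd a v hv
  obtain ⟨z, hz⟩ := hσ.dvd c w hw
  simp only at hf hg
  rw [hσ.clear_eq (r := r) hv (by rw [← hf, mul_comm]) hp.symm hy,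
    hσ.clear_eq (r := s) hw (by rw [← hg, mul_comm]) hq.symm hz,
    hσ.clear_eq (r := r * s) (y := y * z) (a := a + c) (b := b + d) (mul_mem hv hw)
      (by simp only [map_mul, ← hf, ← hg]; ring) (by rw [hp, hq, add_add_add_comm])
      (by rw [hσ.add_eq_mul, hy, hz, map_mul]; ring), hσ.add_eq_mul, map_mul]
  ring

theorem IsDivisiblePower.clear_algebraMap (q : PosRat) (r : R) :
    hσ.clear q (algebraMap R L r) = δ r * σ q := by
  obtain ⟨a, b, -, hq, -⟩ := PosRat.exists_add_add q q
  rw [hσ.clear_eq (r := r) (v := 1) (y := σ a) (one_mem M) (by simp) hq.symm (by simp), mul_assoc,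
    ← hσ.add_eq_mul, ← hq]

theorem IsDivisiblePower.clear_algebraMap_mul (q : PosRat) (r : R) (f : L) :
    hσ.clear q (algebraMap R L r * f) = δ r * hσ.clear q f := by
  obtain ⟨a, b, -, hq, -⟩ := PosRat.exists_add_add q q
  obtain ⟨⟨s, v, hv⟩, hf⟩ := IsLocalization.surj M f
  obtain ⟨y, hy⟩ := hσ.dvd a v hv
  simp only at hf
  rw [hσ.clear_eq (f := f) (r := s) hv (by rw [← hf, mul_comm]) hq.symm hy,
    hσ.clear_eq (f := algebraMap R L r * f) (r := r * s) hv (by simp only [map_mul, ← hf]; ring) hq.symm hy, map_mul]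
  ring

/-- The additive homomorphism underlying `clearHom`. -/
noncomputable def IsDivisiblePower.clearAddHom : AddMonoidAlgebra L PosRat →+ 𝒢 :=
  (Finsupp.liftAddHom fun q => AddMonoidHom.mk' (hσ.clear (L := L) q) (hσ.clear_add q)).comp
    AddMonoidAlgebra.coeffAddEquiv.toAddMonoidHom

theorem IsDivisiblePower.clearAddHom_single (q : PosRat) (f : L) :
    hσ.clearAddHom (AddMonoidAlgebra.single q f) = hσ.clear q f := by
  change Finsupp.liftAddHom _ (AddMonoidAlgebra.single q f).coeff = _
  rw [AddMonoidAlgebra.coeff_single, Finsupp.liftAddHom_apply_single]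
  rfl

/-- The homomorphism sending `(r / v) T ^ q` to `r (σ q / v)`. -/
noncomputable def IsDivisiblePower.clearHom : AddMonoidAlgebra L PosRat →ₙ+* 𝒢 where
  __ := hσ.clearAddHom (L := L)
  map_mul' a b := by
    change hσ.clearAddHom (a * b) = hσ.clearAddHom a * hσ.clearAddHom b
    induction a using AddMonoidAlgebra.induction_linear with
    | zero => simp
    | add a a' ha ha' => rw [add_mul, map_add, ha, ha', map_add, add_mul]
    | single p f =>
      induction b using AddMonoidAlgebra.induction_linear with
      | zero => simp
      | add b b' hb hb' => rw [mul_add, map_add, hb, hb', map_add, mul_add]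
      | single q g =>
        rw [AddMonoidAlgebra.single_mul_single, hσ.clearAddHom_single, hσ.clearAddHom_single,
          hσ.clearAddHom_single, hσ.clear_mul]

@[simp]
theorem IsDivisiblePower.clearHom_single (q : PosRat) (f : L) :
    hσ.clearHom (AddMonoidAlgebra.single q f) = hσ.clear q f :=
  hσ.clearAddHom_single q f

end Denominators

/-! ### The dilation principle. -/

section Dilation

open Filter Polynomial

variable {A : Type*} [CommRing A] (S : Submonoid A)

/-- The filter on pairs `(s, k)` along which `s` becomes divisible by any given element of `S`
and `k` tends to infinity. -/
def divFilter : Filter (S × ℕ) where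
  sets := {U | ∃ (v : S) (K : ℕ), ∀ (w : S) (k : ℕ), K ≤ k → (v * w, k) ∈ U}
  univ_sets := ⟨1, 0, fun _ _ _ => trivial⟩
  sets_of_superset := fun ⟨v, K, h⟩ hUV => ⟨v, K, fun w k hk => hUV (h w k hk)⟩
  inter_sets := by
    rintro U U' ⟨v, K, h⟩ ⟨v', K', h'⟩
    refine ⟨v * v', max K K', fun w k hk => ⟨?_, ?_⟩⟩
    · rw [mul_assoc]
      exact h _ _ ((le_max_left _ _).trans hk)
    · rw [mul_comm v, mul_assoc]
      exact h' _ _ ((le_max_right _ _).trans hk)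

variable {S}

theorem eventually_divFilter_iff {P : S × ℕ → Prop} : (∀ᶠ z in divFilter S, P z) ↔
    ∃ (v : S) (K : ℕ), ∀ (w : S) (k : ℕ), K ≤ k → P (v * w, k) :=
  Iff.rfl

theorem eventually_le_divFilter (K : ℕ) : ∀ᶠ z in divFilter S, K ≤ z.2 :=
  eventually_divFilter_iff.2 ⟨1, K, fun _ _ h => h⟩

theorem eventually_dvd_divFilter (v : S) : ∀ᶠ z in divFilter S, ∃ w : S, z.1 = v * w :=
  eventually_divFilter_iff.2 ⟨v, 0, fun w _ _ => ⟨w, rfl⟩⟩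

/-- The exponent `q k!`. -/
noncomputable def PosRat.expo (q : PosRat) (k : ℕ) : ℕ := ⌊(q : ℚ) * k.factorial⌋₊

/-- The factorial makes q k! an integer for all large k, so the floor in `expo` is eventually exact;
its earlier values are irrelevant for germs. -/
theorem PosRat.cast_expo (q : PosRat) {k : ℕ} (hk : (q : ℚ).den ≤ k) :
    (q.expo k : ℚ) = q * k.factorial := by
  obtain ⟨n, hn⟩ := Nat.dvd_factorial (q : ℚ).den_pos hk
  have h0 : (0 : ℚ) ≤ q := q.2.le
  have h1 : (q : ℚ) * k.factorial = (((q : ℚ).num.toNat * n : ℕ) : ℚ) := by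
    have h2 : (((q : ℚ).num.toNat : ℕ) : ℤ) = (q : ℚ).num := Int.toNat_of_nonneg
      (Rat.num_nonneg.2 h0)
    have h3 : (((q : ℚ).num.toNat : ℕ) : ℚ) = ((q : ℚ).num : ℚ) := by exact_mod_cast h2
    rw [hn]
    push_cast
    rw [h3, ← mul_assoc, Rat.mul_den_eq_num]
  rw [PosRat.expo, h1, Nat.floor_natCast]

variable (S) in
/-- The germ of `s ^ (q k!)`. -/
noncomputable def powGerm (q : PosRat) : Germ (divFilter S) A[X] :=
  ((fun z => C ((z.1 : A) ^ q.expo z.2) : S × ℕ → A[X]) : Germ (divFilter S) A[X])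

variable (S) in
/-- Constant germs. -/
noncomputable def constGerm : A[X] →+* Germ (divFilter S) A[X] :=
  (Germ.coeRingHom (divFilter S)).comp (Pi.constRingHom (S × ℕ) A[X])

theorem isDivisiblePower_powGerm :
    IsDivisiblePower (S.map C) (constGerm S) (powGerm S) where
  add_eq_mul p q := by
    refine Germ.coe_eq.2 ?_
    filter_upwards [eventually_le_divFilter (p : ℚ).den, eventually_le_divFilter (q : ℚ).den,
      eventually_le_divFilter ((p + q : PosRat) : ℚ).den] with z h1 h2 h3
    have : (p + q).expo z.2 = p.expo z.2 + q.expo z.2 := by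
      have e1 := PosRat.cast_expo p h1
      have e2 := PosRat.cast_expo q h2
      have e3 := PosRat.cast_expo (p + q) h3
      push_cast [add_mul] at e3
      rw [← e1, ← e2] at e3
      exact_mod_cast e3
    change C ((z.1 : A) ^ (p + q).expo z.2) = C ((z.1 : A) ^ p.expo z.2) * C ((z.1 : A) ^ q.expo z.2)
    rw [this, pow_add, C_mul]
  dvd q v hv := by
    classical
    obtain ⟨v, hv, rfl⟩ := hv
    -- The default value 0 occurs only off a set of the filter.
    let y : S × ℕ → A[X] := fun z =>
      if h : ∃ y, C ((z.1 : A) ^ q.expo z.2) = C v * y then h.choose else 0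
    refine ⟨y, Germ.coe_eq.2 ?_⟩
    filter_upwards [eventually_le_divFilter (q : ℚ).den, eventually_dvd_divFilter ⟨v, hv⟩]
      with z h1 ⟨w, hw⟩
    have h2 : ∃ y, C ((z.1 : A) ^ q.expo z.2) = C v * y := by
      have e1 := PosRat.cast_expo q h1
      -- A positive exponent is needed for divisibility of the base by v to pass to its power.
      have e2 : q.expo z.2 ≠ 0 := by
        intro h0
        rw [h0, Nat.cast_zero] at e1
        exact (mul_pos q.2 (Nat.cast_pos.2 z.2.factorial_pos)).ne e1
      obtain ⟨n, hn⟩ := Nat.exists_eq_succ_of_ne_zero e2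
      refine ⟨C (w * (z.1 : A) ^ n), ?_⟩
      rw [hn, pow_succ', ← C_mul]
      nth_rw 1 [hw]
      simp [mul_assoc]
    have h3 : y z = h2.choose := dif_pos h2
    change _ = C v * y z
    rw [h3]
    exact h2.choose_spec

variable {C' : Type*} [CommRing C']

/-- The component of degree `i > 0` of `augmentationMap`. -/
noncomputable def augmentationMonomial (i : ℕ) (a : C') : AddMonoidAlgebra C'[X] PosRat :=
  if hi : 0 < i then AddMonoidAlgebra.single ⟨i, Nat.cast_pos.2 hi⟩ (monomial i a) else 0

theorem augmentationMonomial_add (i : ℕ) (a b : C') : augmentationMonomial i (a + b) =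
    augmentationMonomial i a + augmentationMonomial i b := by
  unfold augmentationMonomial
  split_ifs
  · rw [map_add, AddMonoidAlgebra.single_add]
  · rw [add_zero]

theorem augmentationMonomial_zero (i : ℕ) : augmentationMonomial i (0 : C') = 0 := by
  unfold augmentationMonomial
  split_ifs
  · rw [map_zero, AddMonoidAlgebra.single_zero]
  · rfl

variable (C') in
/-- The map `f ↦ f(T X) - f(0)`. -/
noncomputable def augmentationAddHom : C'[X] →+ AddMonoidAlgebra C'[X] PosRat :=
  AddMonoidHom.mk' (fun f => f.sum augmentationMonomial) fun f g =>
    sum_add_index f g _ augmentationMonomial_zero augmentationMonomial_add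

theorem augmentationAddHom_monomial (i : ℕ) (a : C') :
    augmentationAddHom C' (monomial i a) = augmentationMonomial i a :=
  sum_monomial_index a _ (augmentationMonomial_zero i)

variable (C') in
/-- The augmentation map `f ↦ f(T X) - f(0)` on a polynomial ring. -/
noncomputable def augmentationMap :
    AugmentationMap (evalRingHom (0 : C')) (AddMonoidAlgebra C'[X] PosRat) where
  toFun := augmentationAddHom C'
  map_mul f g := by
    induction f using Polynomial.induction_on' with
    | add f f' hf hf' =>
      rw [add_mul, map_add, hf, hf', map_add, map_add, add_mul, add_smul, smul_add]
      abel
    | monomial i a =>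
      induction g using Polynomial.induction_on' with
      | add g g' hg hg' =>
        rw [mul_add, map_add, hg, hg', map_add, map_add, mul_add, add_smul, smul_add]
        abel
      | monomial j b =>
        have heval : ∀ (i : ℕ) (a : C'), 0 < i → evalRingHom (0 : C') (monomial i a) = 0 :=
          fun i a hi => by simp [eval_monomial, hi.ne']
        rw [monomial_mul_monomial, augmentationAddHom_monomial, augmentationAddHom_monomial,
          augmentationAddHom_monomial]
        obtain rfl | hi := Nat.eq_zero_or_pos i
        · obtain rfl | hj := Nat.eq_zero_or_pos j
          · simp [augmentationMonomial]
          · rw [heval j b hj]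
            simp [augmentationMonomial, hj, AddMonoidAlgebra.smul_single, smul_monomial]
        · obtain rfl | hj := Nat.eq_zero_or_pos j
          · rw [heval i a hi]
            simp [augmentationMonomial, hi, AddMonoidAlgebra.smul_single, smul_monomial, mul_comm]
          · rw [heval i a hi, heval j b hj, zero_smul, zero_smul, add_zero, add_zero]
            simp only [augmentationMonomial, hi, hj, Nat.add_pos_left hi j, dif_pos,
              AddMonoidAlgebra.single_mul_single, monomial_mul_monomial]
            congr 1
            exact Subtype.ext (by push_cast; rfl)

variable {ι V V' κ W W' : Type*}
    [AddCommGroup V] [Module ℝ V] [AddCommGroup V'] [Module ℝ V']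
    [AddCommGroup W] [Module ℝ W] [AddCommGroup W'] [Module ℝ W']
  {Φ : RootPairing ι ℝ V V'} {B N : ι → ι → ℤ} (h : SimplyLacedForm Φ.root B)
  (hN : StructureConstants Φ.root B N)
  {Ψ : RootPairing κ ℝ W W'} {BΨ : κ → κ → ℤ} (hΨ : SimplyLacedForm Ψ.root BΨ)
  (f : Embedding Ψ Φ) (hB : ∀ k l, B (f.toIndex k) (f.toIndex l) = BΨ k l)

include h hN hΨ hB in
/-- **Dilation principle.** If an element of `St(Φ, A[X])` that vanishes at `X = 0` comes from the
subsystem after localization in `S`, then one of its dilations by elements of `S` does. -/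
theorem St.exists_dilation_mem_range (hΦ : IsSimplyLaced Φ) (S : Submonoid A) (C' : Type*)
    [CommRing C'] [Algebra A C'] [IsLocalization S C'] {s : St Φ N A[X]}
    (hs : St.map Φ N (evalRingHom 0) s = 1)
    (hs' : St.map Φ N (mapRingHom (algebraMap A C')) s ∈ (St.ofEmbedding f hΦ N C'[X]).range) :
    ∃ a ∈ S, St.map Φ N (eval₂RingHom C (C a * X)) s ∈ (St.ofEmbedding f hΦ N A[X]).range := by
  let _ : Algebra A[X] C'[X] := Polynomial.algebra ..
  have : IsLocalization (S.map C) C'[X] := Polynomial.isLocalization S C'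
  have hσ := isDivisiblePower_powGerm (S := S)
  have hρ : ∀ (a : A) (p : AddMonoidAlgebra C'[X] PosRat),
      hσ.clearHom (algebraMap A C' a • p) =
        ((C a : A[X]) : Germ (divFilter S) A[X]) * hσ.clearHom p := by
    intro a p
    induction p using AddMonoidAlgebra.induction_linear with
    | zero => simp
    | add p q hp hq => rw [smul_add, map_add, hp, hq, map_add, mul_add]
    | single q g =>
      have : algebraMap A C' a • g = algebraMap A[X] C'[X] (C a) * g := by
        rw [algebraMap_def, coe_mapRingHom, map_C, smul_eq_C_mul]
      rw [AddMonoidAlgebra.smul_single, this, hσ.clearHom_single, hσ.clear_algebraMap_mul,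
        hσ.clearHom_single]
      rfl
  -- T^i goes to the germ of s^(i k!), hence g(TX) - g(0) goes to g(s^(k!) X) - g(0); the constant
  -- term is then added back.
  have hθ : ∀ g : A[X], hσ.clearHom ((augmentationMap C').toFun
      (mapRingHom (algebraMap A C') g)) +
      ((C (evalRingHom 0 g) : A[X]) : Germ (divFilter S) A[X]) =
      ((fun z => eval₂RingHom C (C ((z.1 : A) ^ z.2.factorial) * X) g : S × ℕ → A[X]) :
        Germ (divFilter S) A[X]) := by
    intro g
    induction g using Polynomial.induction_on' with
    | add g g' hg hg' =>
      rw [map_add, map_add, map_add, map_add, C_add]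
      have e1 : ((C (evalRingHom 0 g) + C (evalRingHom 0 g') : A[X]) :
        Germ (divFilter S) A[X]) = (C (evalRingHom 0 g) : A[X]) + (C (evalRingHom 0 g') : A[X]) :=
          rfl
      rw [e1, add_add_add_comm, hg, hg']
      refine Germ.coe_eq.2 (Eventually.of_forall fun z => ?_)
      simp only [map_add]
    | monomial i a =>
      change hσ.clearHom (augmentationAddHom C' _) + _ = _
      rw [coe_mapRingHom, map_monomial, augmentationAddHom_monomial, augmentationMonomial]
      split_ifs with hi
      · have e1 : monomial i (algebraMap A C' a) = algebraMap A[X] C'[X] (monomial i a) := by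
          rw [algebraMap_def, coe_mapRingHom, map_monomial]
        rw [e1, hσ.clearHom_single, hσ.clear_algebraMap]
        refine Germ.coe_eq.2 (Eventually.of_forall fun z => ?_)
        have e2 : PosRat.expo ⟨i, Nat.cast_pos.2 hi⟩ z.2 = z.2.factorial * i := by
          rw [PosRat.expo, mul_comm]
          have := Nat.floor_natCast (R := ℚ) (z.2.factorial * i)
          rwa [Nat.cast_mul] at this
        simp [e2, hi.ne', mul_pow, pow_mul, ← C_mul_X_pow_eq_monomial]
        ring
      · obtain rfl : i = 0 := by omega
        rw [map_zero, zero_add]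
        refine Germ.coe_eq.2 (Eventually.of_forall fun z => ?_)
        simp
  have := St.eventually_map_mem_range h hN hasRegularFactors_addMonoidAlgebra (augmentationMap C')
    hσ.clearHom (algebraMap A C') C hρ (mapRingHom (algebraMap A C')) (evalRingHom 0)
    (fun g => by rw [coe_evalRingHom, coe_mapRingHom, coe_evalRingHom, ← coeff_zero_eq_eval_zero,
      coeff_map, coeff_zero_eq_eval_zero])
    (fun z => eval₂RingHom C (C ((z.1 : A) ^ z.2.factorial) * X)) hθ hΨ f hB hΦ hs hs'
  -- Any point of a set in the filter gives a dilation; (v, K) gives a = v^(K!).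
  obtain ⟨v, K, hv⟩ := eventually_divFilter_iff.1 this
  exact ⟨_, (S.pow_mem (v * 1).2 K.factorial), hv 1 K le_rfl⟩

end Dilation

end RelSteinberg

/-! ### Quillen patching. -/

namespace RelSteinberg

open Polynomial

section

variable {ι κ V V' W W' : Type*}
  [AddCommGroup V] [Module ℝ V] [AddCommGroup V'] [Module ℝ V']
  [AddCommGroup W] [Module ℝ W] [AddCommGroup W'] [Module ℝ W']
  {Φ : RootPairing ι ℝ V V'} {Ψ : RootPairing κ ℝ W W'}

theorem Embedding.finrank_le [Finite ι] [Φ.IsRootSystem] (f : Embedding Ψ Φ) :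
    Module.finrank ℝ W ≤ Module.finrank ℝ V := by
  have : Module.Finite ℝ V := ⟨by
    rw [← RootPairing.IsRootSystem.span_root_eq_top (P := Φ)]
    exact Submodule.fg_span (Set.finite_range _)⟩
  exact LinearMap.finrank_le_finrank_of_injective f.injective

theorem Embedding.pairingIn_toIndex [Φ.IsCrystallographic] [Ψ.IsCrystallographic]
    (f : Embedding Ψ Φ) (k l : κ) :
    Φ.pairingIn ℤ (f.toIndex k) (f.toIndex l) = Ψ.pairingIn ℤ k l := by
  have h1 := Φ.algebraMap_pairingIn ℤ (f.toIndex k) (f.toIndex l)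
  rw [f.pairing_toIndex, ← Ψ.algebraMap_pairingIn ℤ] at h1
  exact FaithfulSMul.algebraMap_injective ℤ ℝ h1

variable {N : ι → ι → ℤ} {A : Type*} [CommRing A]

/-- The two projections of the double ring coincide after X = 0, so an element killed by `p₁` is
killed by `p₂` followed by evaluation. -/
theorem St.Rel.map_evalRingHom_μ (g : St.Rel Φ N (Ideal.span {(X : A[X])})) :
    St.map Φ N (evalRingHom 0) (St.Rel.μ Φ N _ g) = 1 := by
  obtain ⟨⟨t, ht⟩, rfl⟩ := QuotientGroup.mk_surjective g
  change St.map Φ N (evalRingHom 0) (St.p₂ Φ N _ t) = 1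
  have h0 : (evalRingHom (0 : A)).comp ((RingHom.snd A[X] A[X]).comp
      (doubleRing (Ideal.span {(X : A[X])})).subtype) =
      (evalRingHom (0 : A)).comp ((RingHom.fst A[X] A[X]).comp
      (doubleRing (Ideal.span {(X : A[X])})).subtype) := by
    ext ⟨⟨p, q⟩, hpq⟩
    have h1 : p - q ∈ Ideal.span {(X : A[X])} := Ideal.Quotient.eq.1 hpq
    have h2 := X_dvd_iff.1 (Ideal.mem_span_singleton.1 h1)
    rw [coeff_zero_eq_eval_zero, eval_sub, sub_eq_zero] at h2
    exact h2.symm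
  rw [St.p₂, St.map_comp_apply, h0, ← St.map_comp_apply]
  rw [MonoidHom.mem_ker, St.p₁] at ht
  rw [ht, map_one]

variable (f : Embedding Ψ Φ) (hΦ : IsSimplyLaced Φ)

/-- The elements `a` such that moving the argument of `s` by a multiple of `a` changes it only by a
factor from the Steinberg group of the subsystem. -/
def St.dilationIdeal (N : ι → ι → ℤ) (s : St Φ N A[X]) : Ideal A where
  carrier := {a | ∀ u v : A[X], St.map Φ N (eval₂RingHom C (u + C a * v)) s *
    (St.map Φ N (eval₂RingHom C u) s)⁻¹ ∈ (St.ofEmbedding f hΦ N A[X]).range}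
  zero_mem' u v := by simp
  -- The quotient telescopes through the intermediate point u + av, which is why u must be arbitrary
  -- in the definition.
  add_mem' {a b} ha hb u v := by
    have := mul_mem (hb (u + C a * v) v) (ha u v)
    rwa [← mul_assoc, inv_mul_cancel_right, add_assoc, ← add_mul, ← C_add] at this
  smul_mem' b a ha u v := by
    have := ha u (C b * v)
    rwa [← mul_assoc, ← C_mul, mul_comm a b] at this

/-- The substitution `p ↦ p (Y + X)`. -/
noncomputable def shift (A : Type*) [CommRing A] : A[X] →+* A[X][X] :=
  eval₂RingHom ((C : A[X] →+* A[X][X]).comp C) (C X + X)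

variable {f hΦ} {B : ι → ι → ℤ} {BΨ : κ → κ → ℤ}

/-- The dilation principle is applied over A[Y] to s(Y + X) s(Y)⁻¹, which vanishes at X = 0 whether
or not s does. It yields s(Y + aX) s(Y)⁻¹, and Y, X are then specialized to u, v. -/
theorem St.exists_mem_dilationIdeal (h : SimplyLacedForm Φ.root B)
    (hN : StructureConstants Φ.root B N) (hΨ : SimplyLacedForm Ψ.root BΨ)
    (hB : ∀ k l, B (f.toIndex k) (f.toIndex l) = BΨ k l) (S : Submonoid A) (A' : Type*)
    [CommRing A'] [Algebra A A'] [IsLocalization S A'] {s : St Φ N A[X]}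
    (hs : St.map Φ N (mapRingHom (algebraMap A A')) s ∈ (St.ofEmbedding f hΦ N A'[X]).range) :
    ∃ a ∈ S, a ∈ St.dilationIdeal f hΦ N s := by
  let _ : Algebra A[X] A'[X] := Polynomial.algebra ..
  have : IsLocalization (S.map C) A'[X] := Polynomial.isLocalization S A'
  have h0 : St.map Φ N (evalRingHom 0) (St.map Φ N (shift A) s * (St.map Φ N C s)⁻¹) = 1 := by
    rw [map_mul, map_inv, St.map_comp_apply, St.map_comp_apply, mul_inv_eq_one]
    have e : (evalRingHom 0).comp (shift A) = (evalRingHom 0).comp C := by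
      ext <;> simp [shift]
    rw [e]
  have h1 : St.map Φ N (mapRingHom (algebraMap A[X] A'[X]))
      (St.map Φ N (shift A) s * (St.map Φ N C s)⁻¹) ∈ (St.ofEmbedding f hΦ N A'[X][X]).range := by
    have h1 := mul_mem (St.map_mem_range_ofEmbedding f hΦ (shift A') hs)
      (inv_mem (St.map_mem_range_ofEmbedding f hΦ C hs))
    have e1 : (mapRingHom (algebraMap A[X] A'[X])).comp (shift A) =
        (shift A').comp (mapRingHom (algebraMap A A')) := by
      ext <;> simp [shift, algebraMap_def]
    have e2 : (mapRingHom (algebraMap A[X] A'[X])).comp C =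
        (C : A'[X] →+* A'[X][X]).comp (mapRingHom (algebraMap A A')) := by
      ext <;> simp [algebraMap_def]
    rw [St.map_comp_apply, St.map_comp_apply] at h1
    rwa [map_mul, map_inv, St.map_comp_apply, St.map_comp_apply, e1, e2]
  obtain ⟨_, ⟨a, ha, rfl⟩, hmem⟩ :=
    St.exists_dilation_mem_range h hN hΨ f hB hΦ (S.map C) A'[X] h0 h1
  refine ⟨a, ha, fun u v => ?_⟩
  have := St.map_mem_range_ofEmbedding f hΦ (eval₂RingHom (eval₂RingHom C u) v) hmem
  simp only [map_mul, map_inv, St.map_comp_apply] at this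
  have e1 : (eval₂RingHom (eval₂RingHom C u) v).comp
      ((eval₂RingHom C (C (C a) * X)).comp (shift A)) = eval₂RingHom C (u + C a * v) := by
    ext <;> simp [shift]
  have e2 : (eval₂RingHom (eval₂RingHom C u) v).comp
      ((eval₂RingHom C (C (C a) * X)).comp C) = eval₂RingHom C u := by
    ext <;> simp
  rwa [e1, e2] at this

/-- Take a = 1, u = 0 and v = X in the definition of the ideal. -/
theorem St.mem_range_of_dilationIdeal_eq_top {s : St Φ N A[X]}
    (hs : St.map Φ N (evalRingHom 0) s = 1) (htop : St.dilationIdeal f hΦ N s = ⊤) :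
    s ∈ (St.ofEmbedding f hΦ N A[X]).range := by
  have h1 : (1 : A) ∈ St.dilationIdeal f hΦ N s := htop ▸ Submodule.mem_top
  have := h1 0 X
  have e0 : eval₂RingHom C (0 : A[X]) = C.comp (evalRingHom 0) := by ext <;> simp
  have e1 : eval₂RingHom C (0 + C 1 * X : A[X]) = RingHom.id _ := by ext <;> simp
  rwa [e0, e1, St.map_id_apply, ← St.map_comp_apply, hs, map_one, inv_one, mul_one] at this

end

end RelSteinberg

open RelSteinberg in
theorem mainTheorem9 {ι κ V V' W W' : Type*}
    [AddCommGroup V] [Module ℝ V] [AddCommGroup V'] [Module ℝ V']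
    [AddCommGroup W] [Module ℝ W] [AddCommGroup W'] [Module ℝ W']
    [Finite ι] [Finite κ]
    -- the ambient root system with its structure constants
    (Φ : RootPairing ι ℝ V V') [Φ.IsRootSystem] [Φ.IsCrystallographic] [Φ.IsReduced]
    [Φ.IsIrreducible] (hΦ : IsSimplyLaced Φ)
    (N : ι → ι → ℤ) (hN : IsStructureConstants Φ N)
    -- the root subsystem
    (Ψ : RootPairing κ ℝ W W') [Ψ.IsRootSystem] [Ψ.IsCrystallographic] [Ψ.IsReduced]
    [Ψ.IsIrreducible] (hΨ : IsSimplyLaced Ψ) (hrank : 3 ≤ Module.finrank ℝ W)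
    (f : Embedding Ψ Φ)
    {A : Type*} [CommRing A]
    (g : St.Rel Φ N (Ideal.span {(Polynomial.X : Polynomial A)})) :
    St.Rel.μ Φ N _ g ∈ (St.ofEmbedding f hΦ N (Polynomial A)).range ↔
      ∀ (M : Ideal A) [M.IsMaximal],
        St.map Φ N (Polynomial.mapRingHom (algebraMap A (Localization.AtPrime M)))
            (St.Rel.μ Φ N _ g) ∈
          (St.ofEmbedding f hΦ N (Polynomial (Localization.AtPrime M))).range := by
  refine ⟨fun hg M _ => St.map_mem_range_ofEmbedding f hΦ _ hg, fun hg => ?_⟩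
  refine St.mem_range_of_dilationIdeal_eq_top (St.Rel.map_evalRingHom_μ g) ?_
  -- A proper ideal would lie in some maximal M, but the hypothesis at M yields a member outside M.
  by_contra hne
  obtain ⟨M, hM, hle⟩ := Ideal.exists_le_maximal _ hne
  obtain ⟨a, haM, ha⟩ := St.exists_mem_dilationIdeal
    (simplyLacedForm_pairingIn Φ hΦ (hrank.trans f.finrank_le))
    (structureConstants_of_isStructureConstants Φ hΦ N hN)
    (simplyLacedForm_pairingIn Ψ hΨ hrank) f.pairingIn_toIndex M.primeCompl
    (Localization.AtPrime M) (hg M)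
  exact haM (hle ha)
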